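/- **Theorem (Gauss formula).** Let $M$ be a connected smooth manifold of dimension $m>2$ with a smooth symmetric $(0,2)$-tensor field $g=\langle\cdot,\cdot\rangle$ such that $(M,g)$ is a *transverse Riemann–Lorentz space with tangent radical*: the set $\Sigma$ of points where $g$ is degenerate is non-void; in every local coordinate system the differential of $\det(g_{ab})$ is non-zero at the points of $\Sigma$ (so $\Sigma$ is a hypersurface and the radical $\mathrm{Rad}_p=\{v:\langle v,\cdot\rangle=0\}$ is a line for $p\in\Sigma$); $g$ is Riemannian or Lorentzian at each point of $M\setminus\Sigma$ and changes from one to the other across $\Sigma$; and $\mathrm{Rad}_p\subset T_p\Sigma$ for all $p\in\Sigma$. *Notation.* Let $\nabla$ and $R(\cdot,\cdot)\cdot$ be the Levi-Civita connection and curvature of $g$ on $M\setminus\Sigma$, and let $\square_{\mathcal A}\mathcal B(\mathcal C)$ be the dual connection on $M$, given by the Koszul formula $$2\square_{\mathcal A}\mathcal B(\mathcal C)=\mathcal A\langle\mathcal B,\mathcal C\rangle+\mathcal B\langle\mathcal C,\mathcal A\rangle-\mathcal C\langle\mathcal A,\mathcal B\rangle+\langle[\mathcal A,\mathcal B],\mathcal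 C\rangle-\langle[\mathcal B,\mathcal C],\mathcal A\rangle+\langle[\mathcal C,\mathcal A],\mathcal B\rangle .$$ Work on an open set $U\subset M$ on which the following canonical objects are given (they exist locally around each point of $\Sigma$). The *main normal* $N$ and the *main radical field* $R$ are smooth vector fields along $\Sigma\cap U$ with $N\perp T\Sigma$, $\langle N,N\rangle=1$, $R(p)\in\mathrm{Rad}_p$, $II(N,N)=0$ and $\mathcal H(R,R)=-1$, where, computing with arbitrary local extensions, $II(A,B)=\square_AB(R)$ for $A,B$ along $\Sigma$, and $\mathcal H(X,Y)=\square_XY(N)$ for $X,Y$ tangent to $\Sigma$ (the second fundamental form). The *canonical extension* $\mathcal N$ of $N$ is the smooth extension of $N$ to $U$ with $\nabla_{\mathcal N}\mathcal N=0$ outside $\Sigma$; the *canonical extension* of a field $A$ along $\Sigma$ is its (local) smooth extension $\mathcal A$ with $[\mathcal N,\mathcal A]=0$. *$II$-flat* means $II(V,W)=0$ for all sections $V,W$ of the screen distribution $S_p=\{v\in T_p\Sigma:\mathcal H(v,R(p))=0\}$. Suppose that $\Sigma$ is $II$-flat (in $U$). Let $\nabla^\Sigma$ be the *tangential connection* on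 $\Sigma\cap U$: for vector fields $X,Y$ on $\Sigma\cap U$ with canonical extensions $\mathcal X,\mathcal Y$, $$\nabla^\Sigma_XY=\nabla_{\mathcal X}\mathcal Y|_\Sigma-\langle\nabla_{\mathcal X}\mathcal Y|_\Sigma,N\rangle N,$$ where $\nabla_{\mathcal X}\mathcal Y|_\Sigma$ is the restriction to $\Sigma$ of the smooth extension of $\nabla_{\mathcal X}\mathcal Y$ across $\Sigma$. Let $R^\Sigma(X,Y)Z=\nabla^\Sigma_X\nabla^\Sigma_YZ-\nabla^\Sigma_Y\nabla^\Sigma_XZ-\nabla^\Sigma_{[X,Y]}Z$, and let $X,Y,Z,T$ be vector fields on $\Sigma\cap U$ (tangent to $\Sigma$). Then: 1. $\langle R(X,Y)Z,T\rangle$ is well-defined on $\Sigma\cap U$: for all smooth local extensions $\mathcal X,\mathcal Y,\mathcal Z,\mathcal T$ of $X,Y,Z,T$, the function $\langle R(\mathcal X,\mathcal Y)\mathcal Z,\mathcal T\rangle$ on the complement of $\Sigma$ extends smoothly across $\Sigma$, and the restriction to $\Sigma$ of this extension depends only on $X,Y,Z,T$; 2. on $\Sigma\cap U$, $$\langle R^\Sigma(X,Y)Z,T\rangle=\langle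 R(X,Y)Z,T\rangle-\det\begin{pmatrix}\mathcal H(X,Z)&\mathcal H(Y,Z)\\ \mathcal H(X,T)&\mathcal H(Y,T)\end{pmatrix}.$$ -/

import Mathlib

open Bundle Manifold VectorField Set
open scoped Manifold ContDiff Topology

noncomputable section

namespace RiemannLorentz

/-- Vector fields (no smoothness required) on an `m`-dimensional manifold `M`. A vector field along
a subset `S` of `M` is represented by any such field; only its values on `S` matter. -/
abbrev VField (m : ℕ) (M : Type*) [TopologicalSpace M]
    [ChartedSpace (EuclideanSpace ℝ (Fin m)) M] : Type _ :=
  (x : M) → TangentSpace (𝓡 m) x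

/-- A smooth symmetric `(0,2)`-tensor field on `M` (possibly degenerate). -/
structure SymTensor (m : ℕ) (M : Type*) [TopologicalSpace M]
    [ChartedSpace (EuclideanSpace ℝ (Fin m)) M] [IsManifold (𝓡 m) ∞ M] where
  /-- the bilinear form on each tangent space -/
  form : (x : M) → TangentSpace (𝓡 m) x →L[ℝ] TangentSpace (𝓡 m) x →L[ℝ] ℝ
  symm : ∀ (x : M) (v w : TangentSpace (𝓡 m) x), form x v w = form x w v
  smooth : ContMDiff (𝓡 m) ((𝓡 m).prod
      𝓘(ℝ, EuclideanSpace ℝ (Fin m) →L[ℝ] EuclideanSpace ℝ (Fin m) →L[ℝ] ℝ)) ∞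
    (fun x ↦ TotalSpace.mk' (EuclideanSpace ℝ (Fin m) →L[ℝ] EuclideanSpace ℝ (Fin m) →L[ℝ] ℝ)
      (E := fun y : M ↦ TangentSpace (𝓡 m) y →L[ℝ] TangentSpace (𝓡 m) y →L[ℝ] ℝ) x (form x))

section Fields

variable {m : ℕ} {M : Type*} [TopologicalSpace M] [ChartedSpace (EuclideanSpace ℝ (Fin m)) M]
  [IsManifold (𝓡 m) ∞ M]

/-- The vector field `A` is smooth on the set `V` (used for open `V`). -/
def SmoothOn (A : VField m M) (V : Set M) : Prop :=
  ContMDiffOn (𝓡 m) (𝓡 m).tangent ∞ (fun x ↦ (⟨x, A x⟩ : TangentBundle (𝓡 m) M)) V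

/-- The real function `f` is smooth on the set `V` (used for open `V`). -/
def SmoothFunOn (m : ℕ) {M : Type*} [TopologicalSpace M]
    [ChartedSpace (EuclideanSpace ℝ (Fin m)) M] (f : M → ℝ) (V : Set M) : Prop :=
  ContMDiffOn (𝓡 m) 𝓘(ℝ, ℝ) ∞ f V

/-- The derivative `v(f)` of a function along a tangent vector. -/
def dirDeriv (f : M → ℝ) (x : M) (v : TangentSpace (𝓡 m) x) : ℝ :=
  mfderiv (𝓡 m) 𝓘(ℝ, ℝ) f x v

/-- `A'` is a smooth extension, defined on `V`, of the field `A` along `S`. -/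
def IsExtension (S V : Set M) (A A' : VField m M) : Prop :=
  SmoothOn A' V ∧ ∀ q ∈ S ∩ V, A' q = A q

/-- `A` is a smooth vector field along `S`: near every point of `S` it has a smooth extension. -/
def IsFieldAlong (S : Set M) (A : VField m M) : Prop :=
  ∀ p ∈ S, ∃ V : Set M, IsOpen V ∧ p ∈ V ∧ ∃ A' : VField m M, IsExtension S V A A'

/-- `v` is tangent at `p` to the (embedded) submanifold `S`: it kills all functions which are
smooth near `p` and vanish on `S`. -/
def IsTangentAt (S : Set M) (p : M) (v : TangentSpace (𝓡 m) p) : Prop :=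
  ∀ V : Set M, IsOpen V → p ∈ V → ∀ f : M → ℝ, SmoothFunOn m f V → (∀ q ∈ S ∩ V, f q = 0) →
    dirDeriv f p v = 0

/-- `X` is a smooth vector field on `S`, i.e. a smooth field along `S` tangent to `S`. -/
def IsFieldOn (S : Set M) (X : VField m M) : Prop :=
  IsFieldAlong S X ∧ ∀ p ∈ S, IsTangentAt S p (X p)

/-- The Lie bracket of two vector fields on `S`, computed with smooth local extensions (the value
at points of `S` is independent of the extensions). -/
def bracketOn (S : Set M) (X Y : VField m M) : VField m M := fun p ↦
  Classical.epsilon fun w : TangentSpace (𝓡 m) p ↦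
    ∃ V : Set M, IsOpen V ∧ p ∈ V ∧ ∃ X' Y' : VField m M,
      IsExtension S V X X' ∧ IsExtension S V Y Y' ∧ mlieBracket (𝓡 m) X' Y' p = w

/-- The `i`-th coordinate vector field `∂/∂xᵢ` of a chart. -/
def coordField (e : OpenPartialHomeomorph M (EuclideanSpace ℝ (Fin m))) (i : Fin m) :
    VField m M :=
  mpullback (𝓡 m) (𝓡 m) e (fun _ ↦ EuclideanSpace.single i (1 : ℝ))

/-- `A'` is the canonical extension to `V` of the field `A` along `S`: it is the extension of `A`
generated by the flow of `N'`, i.e. `[N', A'] = 0`. -/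
def IsCanonicalExtension (S V : Set M) (N' A A' : VField m M) : Prop :=
  IsExtension S V A A' ∧ ∀ x ∈ V, mlieBracket (𝓡 m) N' A' x = 0

/-- The curvature `D_X (D_Y Z) - D_Y (D_X Z) - D_[X,Y] Z` of a connection `D` on `S`. -/
def curvatureOn (S : Set M) (D : VField m M → VField m M → VField m M) (X Y Z : VField m M) :
    VField m M := fun p ↦
  D X (D Y Z) p - D Y (D X Z) p - D (bracketOn S X Y) Z p

end Fields

namespace SymTensor

variable {m : ℕ} {M : Type*} [TopologicalSpace M] [ChartedSpace (EuclideanSpace ℝ (Fin m)) M]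
  [IsManifold (𝓡 m) ∞ M] (g : SymTensor m M)

/-- `v` lies in the radical of `g` at `p`. -/
def IsRadical (p : M) (v : TangentSpace (𝓡 m) p) : Prop :=
  ∀ w : TangentSpace (𝓡 m) p, g.form p v w = 0

/-- The singular set `Σ` of `g`: the points where `g` is degenerate. -/
def sing : Set M := {p | ∃ v : TangentSpace (𝓡 m) p, v ≠ 0 ∧ g.IsRadical p v}

/-- The function `det (g_ab)` in a local coordinate system. -/
def coordDet (e : OpenPartialHomeomorph M (EuclideanSpace ℝ (Fin m))) (x : M) : ℝ :=
  Matrix.det (Matrix.of fun a b : Fin m ↦ g.form x (coordField e a x) (coordField e b x))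

/-- `g` is positive definite at `x`. -/
def IsRiemannAt (x : M) : Prop :=
  ∀ v : TangentSpace (𝓡 m) x, v ≠ 0 → 0 < g.form x v v

/-- `g` has Lorentz signature `(-,+,…,+)` at `x`. -/
def IsLorentzAt (x : M) : Prop :=
  ∃ e : TangentSpace (𝓡 m) x, g.form x e e < 0 ∧
    ∀ v : TangentSpace (𝓡 m) x, g.form x e v = 0 → v ≠ 0 → 0 < g.form x v v

/-- `(M, g)` is a transverse Riemann-Lorentz space: `g` is degenerate on a non-void set `Σ`, in all
local coordinates the differential of `det (g_ab)` is nonzero at the points of `Σ`, and the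
signature of `g` changes from Riemann to Lorentz across `Σ`. -/
structure IsTransverseRiemannLorentz : Prop where
  nonempty : g.sing.Nonempty
  transverse : ∀ e ∈ IsManifold.maximalAtlas (𝓡 m) ∞ M, ∀ p ∈ g.sing ∩ e.source,
    mfderiv (𝓡 m) 𝓘(ℝ, ℝ) (g.coordDet e) p ≠ 0
  signature : ∀ x ∉ g.sing, g.IsRiemannAt x ∨ g.IsLorentzAt x
  changes : ∀ p ∈ g.sing, p ∈ closure {x | g.IsRiemannAt x} ∧ p ∈ closure {x | g.IsLorentzAt x}

/-- The radical is tangent to `Σ` at all points of `Σ`. -/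
def HasTangentRadical : Prop :=
  ∀ p ∈ g.sing, ∀ v : TangentSpace (𝓡 m) p, g.IsRadical p v → IsTangentAt g.sing p v

/-- The dual connection `□_A B (C)`, given by the Koszul formula. -/
def dual (A B C : VField m M) (x : M) : ℝ :=
  (1 / 2) * (dirDeriv (fun y ↦ g.form y (B y) (C y)) x (A x)
    + dirDeriv (fun y ↦ g.form y (C y) (A y)) x (B x)
    - dirDeriv (fun y ↦ g.form y (A y) (B y)) x (C x)
    + g.form x (mlieBracket (𝓡 m) A B x) (C x)
    - g.form x (mlieBracket (𝓡 m) B C x) (A x)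
    + g.form x (mlieBracket (𝓡 m) C A x) (B x))

/-- The Levi-Civita derivative `∇_A B` outside `Σ`: at each point `x`, the vector `w` which
satisfies `⟨w, C⟩ = □_A B (C)` for all fields `C` smooth near `x` (unique, as `g` is nondegenerate
at `x`). Its values on `Σ` are meaningless. -/
def nabla (A B : VField m M) : VField m M := fun x ↦
  Classical.epsilon fun w : TangentSpace (𝓡 m) x ↦
    ∀ V : Set M, IsOpen V → x ∈ V → ∀ C : VField m M, SmoothOn C V →
      g.form x w (C x) = g.dual A B C x

/-- The covariant curvature `⟨R(A,B)C, D⟩` of the Levi-Civita connection outside `Σ`. -/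
def curv (A B C D : VField m M) (x : M) : ℝ :=
  g.form x (g.nabla A (g.nabla B C) x - g.nabla B (g.nabla A C) x
    - g.nabla (mlieBracket (𝓡 m) A B) C x) (D x)

/-- The good limit at a point `p` of `Σ` of a vector field `F` on `M - Σ`: the value at `p` of a
field which is smooth around `p` and equal to `F` outside `Σ`. -/
def goodLimit (F : VField m M) : VField m M := fun p ↦
  Classical.epsilon fun w : TangentSpace (𝓡 m) p ↦
    ∃ V : Set M, IsOpen V ∧ p ∈ V ∧ ∃ F' : VField m M, SmoothOn F' V ∧
      (∀ x ∈ V \ g.sing, F' x = F x) ∧ F' p = w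

/-- The function `□_A B (C)` on an open part `S` of `Σ`, for fields `A, B, C` along `S`, computed
with smooth local extensions of `A, B, C`. It is used where it does not depend on the extensions:
when `C` is radical, and when `A` is tangent to `Σ` and `C` is orthogonal to `Σ`. -/
def dualAlong (S : Set M) (A B C : VField m M) (p : M) : ℝ :=
  Classical.epsilon fun r : ℝ ↦
    ∃ V : Set M, IsOpen V ∧ p ∈ V ∧ ∃ A' B' C' : VField m M,
      IsExtension S V A A' ∧ IsExtension S V B B' ∧ IsExtension S V C C' ∧ g.dual A' B' C' p = r

/-- The second fundamental form `𝓗(X,Y) = □_X Y (N)`, for `X, Y` tangent to `Σ`. -/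
def secondForm (S : Set M) (N X Y : VField m M) (p : M) : ℝ := g.dualAlong S X Y N p

/-- The form `II(A,B) = □_A B (R)`, for `A, B` along `Σ`. -/
def II (S : Set M) (R A B : VField m M) (p : M) : ℝ := g.dualAlong S A B R p

/-- `N` is the main normal and `R` a main radical vector field on the open part `S` of `Σ`: `N` is
orthogonal to `Σ`, `II`-isotropic and unitary, `R` is radical, and `𝓗(R,R) = -1`. -/
structure IsMainPair (S : Set M) (N R : VField m M) : Prop where
  normal_smooth : IsFieldAlong S N
  radical_smooth : IsFieldAlong S R
  orthogonal : ∀ p ∈ S, ∀ v : TangentSpace (𝓡 m) p, IsTangentAt S p v → g.form p (N p) v = 0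
  unitary : ∀ p ∈ S, g.form p (N p) (N p) = 1
  radical : ∀ p ∈ S, g.IsRadical p (R p)
  isotropic : ∀ p ∈ S, g.II S R N N p = 0
  normalized : ∀ p ∈ S, g.secondForm S N R R p = -1

/-- `V` is a section of the canonical screen distribution `{v ∈ TΣ | 𝓗(v,R) = 0}` over `S`. -/
def IsScreenField (S : Set M) (N R V : VField m M) : Prop :=
  IsFieldOn S V ∧ ∀ p ∈ S, g.secondForm S N V R p = 0

/-- `Σ` is `II`-flat in the open set `U`: `II(V,W) = 0` for all local sections `V, W` of the
canonical screen distribution. -/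
def IsIIFlat (U : Set M) (N R : VField m M) : Prop :=
  ∀ O : Set M, IsOpen O → O ⊆ U → ∀ V W : VField m M,
    g.IsScreenField (g.sing ∩ O) N R V → g.IsScreenField (g.sing ∩ O) N R W →
      ∀ p ∈ g.sing ∩ O, g.II (g.sing ∩ O) R V W p = 0

/-- `N'` is the canonical extension to `U` of the main normal `N`: it is smooth, extends `N`, and
is geodesic for the Levi-Civita connection outside `Σ`. -/
def IsGeodesicExtension (U : Set M) (N N' : VField m M) : Prop :=
  IsExtension (g.sing ∩ U) U N N' ∧ ∀ x ∈ U \ g.sing, g.nabla N' N' x = 0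

/-- `D` is the tangential connection on `Σ ∩ U`: for vector fields `X, Y` on `Σ ∩ U`, around each
point, `D_X Y` is the good limit of `∇_X' Y'` on `Σ` minus its component along `N`, where `X'`, `Y'`
are the canonical extensions of `X, Y`. -/
def IsTangentialConnection (U : Set M) (N N' : VField m M)
    (D : VField m M → VField m M → VField m M) : Prop :=
  ∀ X Y : VField m M, IsFieldOn (g.sing ∩ U) X → IsFieldOn (g.sing ∩ U) Y →
    ∀ p ∈ g.sing ∩ U, ∃ V : Set M, IsOpen V ∧ p ∈ V ∧ V ⊆ U ∧ ∃ X' Y' : VField m M,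
      IsCanonicalExtension (g.sing ∩ U) V N' X X' ∧ IsCanonicalExtension (g.sing ∩ U) V N' Y Y' ∧
      ∀ q ∈ g.sing ∩ V, D X Y q = g.goodLimit (g.nabla X' Y') q
        - g.form q (g.goodLimit (g.nabla X' Y') q) (N q) • N q

/-- `⟨R(X,Y)Z, T⟩` is well-defined on `Σ ∩ U`, with value `L`: for all smooth local extensions of
`X, Y, Z, T`, the covariant curvature outside `Σ` extends to a smooth function across `Σ`, whose
restriction to `Σ` is `L` (thus independent of the extensions). -/
def IsCurvLimit (U : Set M) (X Y Z T : VField m M) (L : M → ℝ) : Prop :=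
  ∀ V : Set M, IsOpen V → V ⊆ U → ∀ X' Y' Z' T' : VField m M,
    IsExtension (g.sing ∩ U) V X X' → IsExtension (g.sing ∩ U) V Y Y' →
    IsExtension (g.sing ∩ U) V Z Z' → IsExtension (g.sing ∩ U) V T T' →
      ∃ F : M → ℝ, SmoothFunOn m F V ∧ (∀ x ∈ V \ g.sing, F x = g.curv X' Y' Z' T' x) ∧
        ∀ p ∈ g.sing ∩ V, F p = L p

end SymTensor

end RiemannLorentz

end

/-! Off `Σ`, if smooth fields `F`, `F'` represent `∇_Y Z` and `∇_X Z`, then `⟨R(X,Y)Z,T⟩ = □_X F(T)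
- □_Y F'(T) - □_[X,Y] Z(T)`. The Koszul expression is smooth across `Σ`, so the right-hand side
extends as soon as `F` and `F'` do: everything rests on extending `∇_Y Z` smoothly across `Σ`.

Let `G` be the Gram matrix in a coordinate frame and `b` the vector of values of `□_Y Z` on the
frame. Cramer's rule asks for `det G • F = adj(G) b`. By transversality `det G` is a defining
function of `Σ`, so Hadamard's lemma allows the division once `adj(G) b` vanishes on `Σ`. The rows
of `adj(G)` are radical there, so it is enough that `□_Y Z` kills the radical
(`IsTransverseRiemannLorentz.exists_represents`). For `Y`, `Z` tangent to `Σ` this means `II(Y,Z) =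
0`: multiples of `R` turn `Y` and `Z` into screen fields without changing `II`, because the radical
is tangent, and `II`-flatness applies (`IsIIFlat.dual_eq_zero`).

On `Σ`, `∇^Σ_Y Z` equals `F - 𝓗(Y,Z) N` modulo a radical field, which contributes nothing when
differentiated along `X` and paired with `T`. Since `⟨N,T⟩ = 0` gives `□_X N(T) = -𝓗(X,T)`, it
follows that `⟨∇^Σ_X ∇^Σ_Y Z, T⟩ = □_X F(T) + 𝓗(Y,Z) 𝓗(X,T)`
(`IsTangentialConnection.form_second_derivative`). Antisymmetrising in `X`, `Y` gives the Gauss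
formula on `Σ`. It also shows that the limit of the curvature is independent of the extensions, as
neither `R^Σ` nor `𝓗` involves them. -/

/-! ### Hadamard's lemma: division by a defining function. -/

section Hadamard

variable {E : Type*} [NormedAddCommGroup E] [NormedSpace ℝ E]

/-- The integral is the value at `0` of a convolution in `t` of the indicator of `(0,1]` with a
kernel cut off to compact support, so smoothness of convolutions with parameters applies. The
reflection `-s` in the kernel undoes the one in the convolution. -/
theorem contDiff_intervalIntegral_zero_one {F : Type*} [NormedAddCommGroup F] [NormedSpace ℝ F]
    {φ : E × ℝ → F} (hφ : ContDiff ℝ ∞ φ) :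
    ContDiff ℝ ∞ (fun z ↦ ∫ t in (0 : ℝ)..1, φ (z, t)) := by
  let χ : ContDiffBump (0 : ℝ) := ⟨1, 2, one_pos, one_lt_two⟩
  let f : ℝ → ℝ := (Ioc (0 : ℝ) 1).indicator 1
  let k : E → ℝ → F := fun z s ↦ χ s • φ (z, -s)
  have hf : MeasureTheory.LocallyIntegrable f MeasureTheory.volume := by
    refine MeasureTheory.Integrable.locallyIntegrable ?_
    refine (MeasureTheory.integrable_indicator_iff measurableSet_Ioc).2 ?_
    refine MeasureTheory.integrableOn_const ?_ |>.congr_fun (fun x _ ↦ rfl) measurableSet_Ioc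
    simp
  have hk : ContDiff ℝ ∞ (Function.uncurry k) := by
    have h1 : ContDiff ℝ ∞ (fun q : E × ℝ ↦ χ q.2) := χ.contDiff.comp contDiff_snd
    have h2 : ContDiff ℝ ∞ (fun q : E × ℝ ↦ φ (q.1, -q.2)) :=
      hφ.comp (contDiff_fst.prodMk contDiff_snd.neg)
    exact h1.smul h2
  have key := MeasureTheory.contDiffOn_convolution_right_with_param_comp (n := ⊤)
    (μ := MeasureTheory.volume)
    (ContinuousLinearMap.lsmul ℝ ℝ : ℝ →L[ℝ] F →L[ℝ] F) (s := (univ : Set E))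
    (v := fun _ ↦ (0 : ℝ)) contDiffOn_const (f := f) (g := k) (k := Metric.closedBall 0 2)
    isOpen_univ (isCompact_closedBall 0 2) (fun p x _ hx ↦ by
      have : χ x = 0 := χ.zero_of_le_dist (by
        simp only [Metric.mem_closedBall, not_le] at hx
        exact hx.le)
      simp [k, this]) hf hk.contDiffOn
  rw [contDiffOn_univ] at key
  convert key using 2 with z
  rw [MeasureTheory.convolution_def, intervalIntegral.integral_of_le zero_le_one,
    ← MeasureTheory.integral_indicator measurableSet_Ioc]
  congr 1
  ext t
  by_cases ht : t ∈ Ioc (0 : ℝ) 1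
  · have : χ (0 - t) = 1 := χ.one_of_mem_closedBall (by
      simp only [zero_sub, Metric.mem_closedBall, dist_zero_right, norm_neg, Real.norm_eq_abs]
      rw [abs_of_pos ht.1]
      exact ht.2)
    simp [f, k, ht, this, -zero_sub]
  · simp [f, ht]

/-- Integrate the derivative of `f` along the segment from `z` to `z - l z • v`, whose endpoint lies
in the kernel of `l`, where `f` vanishes. -/
theorem exists_contDiff_mul_of_eq_zero {f : E → ℝ} (hf : ContDiff ℝ ∞ f) (l : E →L[ℝ] ℝ) {v : E}
    (hv : l v = 1) (h0 : ∀ z, l z = 0 → f z = 0) :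
    ∃ h : E → ℝ, ContDiff ℝ ∞ h ∧ ∀ z, f z = l z * h z := by
  refine ⟨fun z ↦ ∫ t in (0 : ℝ)..1, fderiv ℝ f (z - (t * l z) • v) v, ?_, fun z ↦ ?_⟩
  · refine contDiff_intervalIntegral_zero_one
      (φ := fun q : E × ℝ ↦ fderiv ℝ f (q.1 - (q.2 * l q.1) • v) v) ?_
    refine ContDiff.clm_apply ?_ contDiff_const
    refine (hf.fderiv_right (m := ∞) (by simp)).comp ?_
    fun_prop
  · have hd : ∀ t : ℝ, HasDerivAt (fun t : ℝ ↦ f (z - (t * l z) • v))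
        (-(l z * fderiv ℝ f (z - (t * l z) • v) v)) t := by
      intro t
      have h1 : HasDerivAt (fun t : ℝ ↦ z - (t * l z) • v) (-((l z) • v)) t := by
        simpa using (((hasDerivAt_id t).mul_const (l z)).smul_const v).const_sub z
      have h2 := ((hf.differentiable (by simp)) (z - (t * l z) • v)).hasFDerivAt.comp_hasDerivAt t h1
      simpa [Function.comp_def] using h2
    have hc : Continuous (fun t : ℝ ↦ -(l z * fderiv ℝ f (z - (t * l z) • v) v)) := by
      have : Continuous (fderiv ℝ f) := hf.continuous_fderiv (by simp)
      fun_prop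
    have := intervalIntegral.integral_eq_sub_of_hasDerivAt (a := 0) (b := 1) (fun t _ ↦ hd t)
      (hc.intervalIntegrable _ _)
    rw [intervalIntegral.integral_neg, intervalIntegral.integral_const_mul] at this
    have h3 : f (z - ((1 : ℝ) * l z) • v) = 0 := h0 _ (by simp [hv])
    simp only [h3, zero_mul, zero_smul, sub_zero, zero_sub] at this
    linarith

theorem eventually_exists_mul_of_linear [FiniteDimensional ℝ E] {f : E → ℝ} {z₀ : E}
    (hf : ∀ᶠ z in 𝓝 z₀, ContDiffAt ℝ ∞ f z) (l : E →L[ℝ] ℝ) {v : E}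
    (hv : l v = 1) (h0 : ∀ᶠ z in 𝓝 z₀, l z = 0 → f z = 0) :
    ∃ h : E → ℝ, ContDiff ℝ ∞ h ∧ ∀ᶠ z in 𝓝 z₀, f z = l z * h z := by
  obtain ⟨r, hr, hball⟩ := Metric.eventually_nhds_iff_ball.1 (hf.and h0)
  -- The cut-off makes the function globally smooth, keeps its vanishing on the kernel of `l`, and
  -- leaves it unchanged near `z₀`.
  let χ : ContDiffBump z₀ := ⟨r / 3, r / 2, by positivity, by linarith⟩
  have hsm : ContDiff ℝ ∞ (fun z ↦ χ z * f z) := by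
    rw [contDiff_iff_contDiffAt]
    intro z
    by_cases hz : z ∈ Metric.ball z₀ r
    · exact χ.contDiffAt.mul (hball z hz).1
    · have : (fun z ↦ χ z * f z) =ᶠ[𝓝 z] fun _ ↦ 0 := by
        have hz' : z ∈ (Metric.closedBall z₀ (r / 2))ᶜ := by
          simp only [mem_compl_iff, Metric.mem_closedBall, not_le, Metric.mem_ball, not_lt] at hz ⊢
          linarith
        filter_upwards [Metric.isClosed_closedBall.isOpen_compl.mem_nhds hz'] with y hy
        have : χ y = 0 := χ.zero_of_le_dist (by
          simp only [mem_compl_iff, Metric.mem_closedBall, not_le] at hy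
          exact hy.le)
        simp [this]
      exact contDiffAt_const.congr_of_eventuallyEq this
  obtain ⟨h, hh, hfh⟩ := exists_contDiff_mul_of_eq_zero hsm l hv (fun z hz ↦ by
    by_cases hz' : z ∈ Metric.ball z₀ r
    · simp [(hball z hz').2 hz]
    · have : χ z = 0 := χ.zero_of_le_dist (by
          simp only [Metric.mem_ball, not_lt] at hz'
          change r / 2 ≤ _
          linarith)
      simp [this])
  refine ⟨h, hh, ?_⟩
  filter_upwards [χ.eventuallyEq_one] with z hz
  have := hfh z
  rw [hz] at this
  simpa using this

/-- The map `Φ` straightens `τ`: it satisfies `l ∘ Φ = τ` and has identity derivative at `y₀`, which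
reduces the division by `τ` to the division by a linear form. -/
theorem eventually_exists_mul_of_fderiv_ne_zero [FiniteDimensional ℝ E] {f τ : E → ℝ} {y₀ : E}
    (hf : ∀ᶠ y in 𝓝 y₀, ContDiffAt ℝ ∞ f y) (hτ : ∀ᶠ y in 𝓝 y₀, ContDiffAt ℝ ∞ τ y)
    (hd : fderiv ℝ τ y₀ ≠ 0) (h0 : ∀ᶠ y in 𝓝 y₀, τ y = 0 → f y = 0) :
    ∃ h : E → ℝ, (∀ᶠ y in 𝓝 y₀, ContDiffAt ℝ ∞ h y) ∧ ∀ᶠ y in 𝓝 y₀, f y = τ y * h y := by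
  have : CompleteSpace E := FiniteDimensional.complete ℝ E
  set l := fderiv ℝ τ y₀ with hl
  obtain ⟨w, hw⟩ : ∃ w, l w ≠ 0 := by
    by_contra! H
    exact hd (ContinuousLinearMap.ext H)
  obtain ⟨v, hv⟩ : ∃ v, l v = 1 := ⟨(l w)⁻¹ • w, by simp [hw]⟩
  let Φ : E → E := fun y ↦ y + (τ y - l y) • v
  have hΦ : ∀ᶠ y in 𝓝 y₀, ContDiffAt ℝ ∞ Φ y := by
    filter_upwards [hτ] with y hy
    exact contDiffAt_id.add ((hy.sub l.contDiff.contDiffAt).smul contDiffAt_const)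
  have hlΦ : ∀ y, l (Φ y) = τ y := fun y ↦ by simp [Φ, hv]
  have hΦ' : HasFDerivAt Φ ((ContinuousLinearEquiv.refl ℝ E : E ≃L[ℝ] E) : E →L[ℝ] E) y₀ := by
    have h1 : HasFDerivAt τ l y₀ :=
      (hτ.self_of_nhds.differentiableAt (by simp)).hasFDerivAt
    have := (hasFDerivAt_id y₀).add ((h1.sub l.hasFDerivAt).smul_const v)
    convert! this using 1
    ext y
    simp
  let e := hΦ.self_of_nhds.toOpenPartialHomeomorph Φ hΦ' (by simp)
  have hey : y₀ ∈ e.source := hΦ.self_of_nhds.mem_toOpenPartialHomeomorph_source hΦ' (by simp)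
  have he : ∀ y, e y = Φ y := fun y ↦ rfl
  -- The inverse has to be smooth on a whole neighbourhood, so `Φ` must have invertible derivative
  -- near `y₀` and not only at it.
  have hequiv : ∀ᶠ y in 𝓝 y₀, fderiv ℝ Φ y ∈ range ((↑) : (E ≃L[ℝ] E) → E →L[ℝ] E) := by
    have hc : ContinuousAt (fderiv ℝ Φ) y₀ :=
      (hΦ.self_of_nhds.fderiv_right (m := ∞) (by simp)).continuousAt
    refine hc.eventually ?_
    rw [hΦ'.fderiv]
    exact ContinuousLinearEquiv.nhds _
  have hback : Filter.Tendsto e.symm (𝓝 (e y₀)) (𝓝 y₀) := e.tendsto_symm hey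
  have hsymm : ∀ᶠ z in 𝓝 (e y₀), ContDiffAt ℝ ∞ e.symm z := by
    filter_upwards [hback.eventually hequiv, hback.eventually hΦ,
      e.open_target.mem_nhds (e.map_source hey)] with z ⟨A, hA⟩ hz2 hz
    refine e.contDiffAt_symm hz (f₀' := A) ?_ hz2
    rw [hA]
    exact (hz2.differentiableAt (by simp)).hasFDerivAt
  obtain ⟨h, hh, hfh⟩ := eventually_exists_mul_of_linear (f := f ∘ e.symm) (z₀ := e y₀) (by
      filter_upwards [hback.eventually hf, hsymm] with z h1 h2
      exact h1.comp z h2) l hv (by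
      filter_upwards [hback.eventually h0, e.open_target.mem_nhds (e.map_source hey)] with z h1 h2 h3
      refine h1 ?_
      rw [← hlΦ, ← he, e.right_inv h2, h3])
  refine ⟨h ∘ Φ, ?_, ?_⟩
  · filter_upwards [hΦ] with y hy
    exact hh.contDiffAt.comp y hy
  · filter_upwards [(e.continuousAt hey).eventually hfh, e.open_source.mem_nhds hey] with y h1 h2
    simp only [Function.comp_apply, e.left_inv h2] at h1
    rw [h1, he, hlΦ]
    rfl

end Hadamard

/-! ### Functions and vector fields smooth near a point. -/

namespace RiemannLorentz

variable {m : ℕ} {M : Type*} [TopologicalSpace M] [ChartedSpace (EuclideanSpace ℝ (Fin m)) M]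

/-- The function `f` is smooth on a neighbourhood of `x`. -/
def SmoothFunNear (m : ℕ) {M : Type*} [TopologicalSpace M]
    [ChartedSpace (EuclideanSpace ℝ (Fin m)) M] (f : M → ℝ) (x : M) : Prop :=
  ∀ᶠ y in 𝓝 x, ContMDiffAt (𝓡 m) 𝓘(ℝ, ℝ) ∞ f y

/-- The function `f` is differentiable at `x`. -/
abbrev DiffFunAt (m : ℕ) {M : Type*} [TopologicalSpace M]
    [ChartedSpace (EuclideanSpace ℝ (Fin m)) M] (f : M → ℝ) (x : M) : Prop :=
  MDifferentiableAt (𝓡 m) 𝓘(ℝ, ℝ) f x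

section Functions

variable {f h : M → ℝ} {x : M} {V : Set M}

theorem SmoothFunOn.smoothFunNear (hf : SmoothFunOn m f V) (hV : IsOpen V) (hx : x ∈ V) :
    SmoothFunNear m f x := by
  filter_upwards [hV.mem_nhds hx] with y hy
  exact (hf y hy).contMDiffAt (hV.mem_nhds hy)

theorem SmoothFunNear.exists_smoothFunOn (hf : SmoothFunNear m f x) :
    ∃ V, IsOpen V ∧ x ∈ V ∧ SmoothFunOn m f V := by
  obtain ⟨V, h1, h2, h3⟩ := eventually_nhds_iff.1 hf
  exact ⟨V, h2, h3, fun y hy ↦ (h1 y hy).contMDiffWithinAt⟩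

theorem SmoothFunNear.eventually (hf : SmoothFunNear m f x) : ∀ᶠ y in 𝓝 x, SmoothFunNear m f y :=
  Filter.Eventually.eventually_nhds hf

theorem SmoothFunNear.diffFunAt (hf : SmoothFunNear m f x) : DiffFunAt m f x :=
  hf.self_of_nhds.mdifferentiableAt (by simp)

theorem smoothFunNear_const (c : ℝ) : SmoothFunNear m (fun _ : M ↦ c) x :=
  Filter.Eventually.of_forall fun _ ↦ contMDiffAt_const

theorem SmoothFunNear.add (hf : SmoothFunNear m f x) (hh : SmoothFunNear m h x) :
    SmoothFunNear m (fun y ↦ f y + h y) x := by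
  filter_upwards [hf, hh] with y h1 h2 using h1.add h2

theorem SmoothFunNear.sub (hf : SmoothFunNear m f x) (hh : SmoothFunNear m h x) :
    SmoothFunNear m (fun y ↦ f y - h y) x := by
  filter_upwards [hf, hh] with y h1 h2 using h1.sub h2

theorem SmoothFunNear.mul (hf : SmoothFunNear m f x) (hh : SmoothFunNear m h x) :
    SmoothFunNear m (fun y ↦ f y * h y) x := by
  filter_upwards [hf, hh] with y h1 h2 using h1.mul h2

theorem SmoothFunNear.neg (hf : SmoothFunNear m f x) : SmoothFunNear m (fun y ↦ - f y) x := by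
  filter_upwards [hf] with y h1 using h1.neg

theorem SmoothFunNear.sum {ι : Type*} {s : Finset ι} {f : ι → M → ℝ}
    (hf : ∀ i ∈ s, SmoothFunNear m (f i) x) : SmoothFunNear m (fun y ↦ ∑ i ∈ s, f i y) x := by
  filter_upwards [(Filter.eventually_all_finset s).2 hf] with y h1 using contMDiffAt_finsetSum h1

theorem SmoothFunNear.prod {ι : Type*} {s : Finset ι} {f : ι → M → ℝ}
    (hf : ∀ i ∈ s, SmoothFunNear m (f i) x) : SmoothFunNear m (fun y ↦ ∏ i ∈ s, f i y) x := by
  filter_upwards [(Filter.eventually_all_finset s).2 hf] with y h1 using contMDiffAt_finsetProd h1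

end Functions

section Fields

variable [IsManifold (𝓡 m) ∞ M] {A B C : VField m M} {f h : M → ℝ} {x : M} {V : Set M}

/-- The vector field `A` is smooth on a neighbourhood of `x`. -/
def SmoothNear (A : VField m M) (x : M) : Prop :=
  ∀ᶠ y in 𝓝 x, ContMDiffAt (𝓡 m) (𝓡 m).tangent ∞ (fun x ↦ (⟨x, A x⟩ : TangentBundle (𝓡 m) M)) y

/-- The vector field `A` is differentiable at `x`. -/
abbrev DiffAt (A : VField m M) (x : M) : Prop :=
  MDifferentiableAt (𝓡 m) (𝓡 m).tangent (fun x ↦ (⟨x, A x⟩ : TangentBundle (𝓡 m) M)) x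

theorem isManifold_minSmoothness (k : WithTop ℕ∞) (hk : k ≤ ∞) :
    IsManifold (𝓡 m) (minSmoothness ℝ k) M :=
  IsManifold.of_le (n := ∞) (by simpa using hk)

instance isManifold_minSmoothness_two : IsManifold (𝓡 m) (minSmoothness ℝ 2) M :=
  isManifold_minSmoothness 2 ENat.LEInfty.out

instance isManifold_minSmoothness_three : IsManifold (𝓡 m) (minSmoothness ℝ 3) M :=
  isManifold_minSmoothness 3 ENat.LEInfty.out

theorem SmoothOn.smoothNear (hA : SmoothOn A V) (hV : IsOpen V) (hx : x ∈ V) : SmoothNear A x := by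
  filter_upwards [hV.mem_nhds hx] with y hy
  exact (hA y hy).contMDiffAt (hV.mem_nhds hy)

theorem SmoothNear.exists_smoothOn (hA : SmoothNear A x) : ∃ V, IsOpen V ∧ x ∈ V ∧ SmoothOn A V := by
  obtain ⟨V, h1, h2, h3⟩ := eventually_nhds_iff.1 hA
  exact ⟨V, h2, h3, fun y hy ↦ (h1 y hy).contMDiffWithinAt⟩

theorem SmoothNear.eventually (hA : SmoothNear A x) : ∀ᶠ y in 𝓝 x, SmoothNear A y :=
  Filter.Eventually.eventually_nhds hA

theorem SmoothNear.diffAt (hA : SmoothNear A x) : DiffAt A x :=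
  hA.self_of_nhds.mdifferentiableAt (by simp)

theorem SmoothNear.add (hA : SmoothNear A x) (hB : SmoothNear B x) : SmoothNear (A + B) x := by
  filter_upwards [hA, hB] with y h1 h2 using h1.add_section h2

theorem SmoothNear.sub (hA : SmoothNear A x) (hB : SmoothNear B x) : SmoothNear (A - B) x := by
  filter_upwards [hA, hB] with y h1 h2 using h1.sub_section h2

theorem SmoothNear.smul (hf : SmoothFunNear m f x) (hA : SmoothNear A x) :
    SmoothNear (f • A) x := by
  filter_upwards [hf, hA] with y h1 h2 using h1.smul_section h2

theorem SmoothNear.sum {ι : Type*} {s : Finset ι} {A : ι → VField m M}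
    (hA : ∀ i ∈ s, SmoothNear (A i) x) : SmoothNear (fun y ↦ ∑ i ∈ s, A i y) x := by
  filter_upwards [(Filter.eventually_all_finset s).2 hA] with y h1
  exact ContMDiffAt.sum_section h1

theorem SmoothNear.mlieBracket (hA : SmoothNear A x) (hB : SmoothNear B x) :
    SmoothNear (mlieBracket (𝓡 m) A B) x := by
  have : IsManifold (𝓡 m) (((⊤ : ℕ∞) : WithTop ℕ∞) + 1) M := ‹IsManifold (𝓡 m) ∞ M›
  filter_upwards [hA, hB] with y h1 h2
  exact ContMDiffAt.mlieBracket_vectorField (m := ⊤) (n := ⊤) h1 h2 (by simp)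

theorem SmoothFunNear.dirDeriv (hf : SmoothFunNear m f x) (hA : SmoothNear A x) :
    SmoothFunNear m (fun y ↦ dirDeriv f y (A y)) x := by
  obtain ⟨V, hV, hxV, hfV⟩ := hf.exists_smoothFunOn
  filter_upwards [hA, hV.mem_nhds hxV] with y h1 hy
  have h2 : ContMDiffOn (𝓡 m).tangent 𝓘(ℝ, ℝ).tangent ∞
      (tangentMapWithin (𝓡 m) 𝓘(ℝ, ℝ) f V) (TotalSpace.proj ⁻¹' V) :=
    ContMDiffOn.contMDiffOn_tangentMapWithin (n := ∞) hfV (by simp) hV.uniqueMDiffOn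
  have hπ : IsOpen (TotalSpace.proj ⁻¹' V : Set (TangentBundle (𝓡 m) M)) :=
    hV.preimage (FiberBundle.continuous_proj _ _)
  have h3 := (h2.contMDiffAt (x := ⟨y, A y⟩) (hπ.mem_nhds hy)).comp y h1
  have h4 := (contMDiff_snd_tangentBundle_modelSpace ℝ 𝓘(ℝ, ℝ)).contMDiffAt.comp y h3
  refine h4.congr_of_eventuallyEq ?_
  filter_upwards [hV.mem_nhds hy] with z hz
  change RiemannLorentz.dirDeriv f z (A z) = mfderivWithin (𝓡 m) 𝓘(ℝ, ℝ) f V z (A z)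
  rw [mfderivWithin_of_isOpen hV hz]
  rfl

end Fields

end RiemannLorentz

/-! ### Lie brackets as derivations, and the algebra of the dual connection. -/

namespace RiemannLorentz

section DirDeriv

variable {m : ℕ} {M : Type*} [TopologicalSpace M] [ChartedSpace (EuclideanSpace ℝ (Fin m)) M]
  {f h : M → ℝ} {x : M}

theorem dirDeriv_vadd (f : M → ℝ) (v w : TangentSpace (𝓡 m) x) :
    dirDeriv f x (v + w) = dirDeriv f x v + dirDeriv f x w := map_add _ _ _

theorem dirDeriv_vzero (f : M → ℝ) : dirDeriv f x (0 : TangentSpace (𝓡 m) x) = 0 := map_zero _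

theorem dirDeriv_vsmul (f : M → ℝ) (c : ℝ) (v : TangentSpace (𝓡 m) x) :
    dirDeriv f x (c • v) = c * dirDeriv f x v := map_smul _ _ _

theorem dirDeriv_congr (hfh : f =ᶠ[𝓝 x] h) (v : TangentSpace (𝓡 m) x) :
    dirDeriv f x v = dirDeriv h x v := by
  unfold dirDeriv
  rw [hfh.mfderiv_eq]
  rfl

theorem dirDeriv_const (c : ℝ) (v : TangentSpace (𝓡 m) x) :
    dirDeriv (fun _ ↦ c) x v = 0 := by
  unfold dirDeriv
  rw [mfderiv_const]
  rfl

theorem dirDeriv_add (hf : DiffFunAt m f x) (hh : DiffFunAt m h x) (v : TangentSpace (𝓡 m) x) :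
    dirDeriv (fun y ↦ f y + h y) x v = dirDeriv f x v + dirDeriv h x v := by
  exact congrArg (fun L : TangentSpace (𝓡 m) x →L[ℝ] ℝ ↦ L v)
    (hf.hasMFDerivAt.add hh.hasMFDerivAt).mfderiv

theorem dirDeriv_mul (hf : DiffFunAt m f x) (hh : DiffFunAt m h x) (v : TangentSpace (𝓡 m) x) :
    dirDeriv (fun y ↦ f y * h y) x v = f x * dirDeriv h x v + dirDeriv f x v * h x := by
  refine (congrArg (fun L : TangentSpace (𝓡 m) x →L[ℝ] ℝ ↦ L v)
    (hf.hasMFDerivAt.mul hh.hasMFDerivAt).mfderiv).trans ?_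
  change f x * dirDeriv h x v + h x * dirDeriv f x v = _
  ring

theorem DiffFunAt.sum {ι : Type*} {s : Finset ι} {f : ι → M → ℝ}
    (hf : ∀ i ∈ s, DiffFunAt m (f i) x) : DiffFunAt m (fun y ↦ ∑ i ∈ s, f i y) x := by
  classical
  induction s using Finset.induction_on with
  | empty => simpa using mdifferentiableAt_const
  | insert a s ha ih =>
    simp only [Finset.mem_insert, forall_eq_or_imp] at hf
    simp only [Finset.sum_insert ha]
    exact hf.1.add (ih hf.2)

theorem dirDeriv_sum {ι : Type*} {s : Finset ι} {f : ι → M → ℝ}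
    (hf : ∀ i ∈ s, DiffFunAt m (f i) x) (v : TangentSpace (𝓡 m) x) :
    dirDeriv (fun y ↦ ∑ i ∈ s, f i y) x v = ∑ i ∈ s, dirDeriv (f i) x v := by
  classical
  induction s using Finset.induction_on with
  | empty => simpa using dirDeriv_const 0 v
  | insert a s ha ih =>
    simp only [Finset.mem_insert, forall_eq_or_imp] at hf
    simp only [Finset.sum_insert ha]
    rw [dirDeriv_add hf.1 (DiffFunAt.sum hf.2), ih hf.2]

theorem lie_congr_left {A A' B : VField m M} (h : A =ᶠ[𝓝 x] A') :
    mlieBracket (𝓡 m) A B x = mlieBracket (𝓡 m) A' B x :=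
  h.mlieBracket_vectorField_eq (Filter.EventuallyEq.refl _ _)

theorem lie_congr_right {A B B' : VField m M} (h : B =ᶠ[𝓝 x] B') :
    mlieBracket (𝓡 m) A B x = mlieBracket (𝓡 m) A B' x :=
  (Filter.EventuallyEq.refl _ _).mlieBracket_vectorField_eq h

end DirDeriv

variable {m : ℕ} {M : Type*} [TopologicalSpace M] [ChartedSpace (EuclideanSpace ℝ (Fin m)) M]
  [IsManifold (𝓡 m) ∞ M]

section Bracket

variable {A B C : VField m M} {f : M → ℝ} {x : M}

theorem lie_smul_right (hf : DiffFunAt m f x) (hB : DiffAt B x) :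
    mlieBracket (𝓡 m) A (f • B) x = dirDeriv f x (A x) • B x + f x • mlieBracket (𝓡 m) A B x :=
  mlieBracket_smul_right hf hB

theorem lie_smul_left (hf : DiffFunAt m f x) (hA : DiffAt A x) :
    mlieBracket (𝓡 m) (f • A) B x =
      -dirDeriv f x (B x) • A x + f x • mlieBracket (𝓡 m) A B x :=
  mlieBracket_smul_left hf hA

/-- Expand the Jacobi identity for `A`, `B`, `f • C` by the Leibniz rule and subtract `f` times the
one for `A`, `B`, `C`. What remains is the difference of the two sides times `C x`, and `C x ≠ 0`.
-/
theorem dirDeriv_mlieBracket_of_ne_zero (hA : SmoothNear A x) (hB : SmoothNear B x)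
    (hCs : SmoothNear C x) (h0 : C x ≠ 0) (hf : SmoothFunNear m f x) :
    dirDeriv f x (mlieBracket (𝓡 m) A B x) =
      dirDeriv (fun y ↦ dirDeriv f y (B y)) x (A x) -
        dirDeriv (fun y ↦ dirDeriv f y (A y)) x (B x) := by
  have two : ∀ {F : VField m M}, SmoothNear F x → ContMDiffAt (𝓡 m) (𝓡 m).tangent
      (minSmoothness ℝ 2) (fun x ↦ (⟨x, F x⟩ : TangentBundle (𝓡 m) M)) x := fun hF ↦
    hF.self_of_nhds.of_le (by simpa using ENat.LEInfty.out)
  have key := leibniz_identity_mlieBracket_apply (two hA) (two hB) (two (hCs.smul hf))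
  have key' := leibniz_identity_mlieBracket_apply (two hA) (two hB) (two hCs)
  have expand : ∀ {F : VField m M}, mlieBracket (𝓡 m) F (f • C) =ᶠ[𝓝 x]
      (fun y ↦ dirDeriv f y (F y)) • C + f • mlieBracket (𝓡 m) F C := fun {F} ↦ by
    filter_upwards [hf.eventually, hCs.eventually] with y h1 h2
    exact lie_smul_right h1.diffFunAt h2.diffAt
  have twice : ∀ {F G : VField m M}, SmoothNear F x → SmoothNear G x →
      mlieBracket (𝓡 m) G (mlieBracket (𝓡 m) F (f • C)) x =
        dirDeriv (fun y ↦ dirDeriv f y (F y)) x (G x) • C x +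
        dirDeriv f x (F x) • mlieBracket (𝓡 m) G C x +
        (dirDeriv f x (G x) • mlieBracket (𝓡 m) F C x +
        f x • mlieBracket (𝓡 m) G (mlieBracket (𝓡 m) F C) x) := fun {F G} hF hG ↦ by
    have hfF := SmoothFunNear.dirDeriv hf hF
    rw [lie_congr_right expand,
      mlieBracket_add_right (hCs.smul hfF).diffAt ((hF.mlieBracket hCs).smul hf).diffAt,
      lie_smul_right hfF.diffFunAt hCs.diffAt,
      lie_smul_right hf.diffFunAt (hF.mlieBracket hCs).diffAt]
  rw [twice hB hA, twice hA hB, lie_smul_right hf.diffFunAt hCs.diffAt, key'] at key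
  have : (dirDeriv f x (mlieBracket (𝓡 m) A B x) - (dirDeriv (fun y ↦ dirDeriv f y (B y)) x (A x) -
        dirDeriv (fun y ↦ dirDeriv f y (A y)) x (B x))) • C x = 0 := by
    simp only [smul_add, sub_smul] at key ⊢
    rw [← sub_eq_zero] at key
    rw [← neg_eq_zero, ← key]
    abel
  exact sub_eq_zero.1 ((smul_eq_zero.1 this).resolve_right h0)

/-- The Lie bracket is the commutator of derivations. -/
theorem dirDeriv_mlieBracket (hA : SmoothNear A x) (hB : SmoothNear B x)
    (hf : SmoothFunNear m f x) :
    dirDeriv f x (mlieBracket (𝓡 m) A B x) =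
      dirDeriv (fun y ↦ dirDeriv f y (B y)) x (A x) -
        dirDeriv (fun y ↦ dirDeriv f y (A y)) x (B x) := by
  -- The auxiliary field is `A` or `B` itself, whichever is nonzero at `x`; if both vanish there, so
  -- does their bracket.
  by_cases hA0 : A x = 0
  · by_cases hB0 : B x = 0
    · have h0 : mlieBracket (𝓡 m) A B x = 0 := by
        rw [← mlieBracketWithin_univ]
        exact mlieBracketWithin_eq_zero_of_eq_zero hA0 hB0
      rw [hA0, hB0, h0, dirDeriv_vzero, dirDeriv_vzero, dirDeriv_vzero, sub_zero]
    · exact dirDeriv_mlieBracket_of_ne_zero hA hB hB hB0 hf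
  · exact dirDeriv_mlieBracket_of_ne_zero hA hB hA hA0 hf

end Bracket

namespace SymTensor

variable (g : SymTensor m M) {A B C : VField m M} {f h : M → ℝ} {x : M}

theorem diffFunAt_form (hA : DiffAt A x) (hB : DiffAt B x) :
    DiffFunAt m (fun y ↦ g.form y (A y) (B y)) x := by
  have h := MDifferentiableAt.clm_bundle_apply₂ (F₁ := EuclideanSpace ℝ (Fin m))
    (F₂ := EuclideanSpace ℝ (Fin m)) (F₃ := ℝ) (E₃ := Trivial M ℝ)
    ((g.smooth x).mdifferentiableAt (by simp)) hA hB
  simp only [mdifferentiableAt_totalSpace] at h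
  exact h.2

theorem smoothFunNear_form (hA : SmoothNear A x) (hB : SmoothNear B x) :
    SmoothFunNear m (fun y ↦ g.form y (A y) (B y)) x := by
  filter_upwards [hA, hB] with y h1 h2
  have h := ContMDiffAt.clm_bundle_apply₂ (F₁ := EuclideanSpace ℝ (Fin m))
    (F₂ := EuclideanSpace ℝ (Fin m)) (F₃ := ℝ) (E₃ := Trivial M ℝ) (g.smooth y) h1 h2
  simp only [contMDiffAt_totalSpace] at h
  exact h.2

theorem smoothFunNear_dual (hA : SmoothNear A x) (hB : SmoothNear B x) (hC : SmoothNear C x) :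
    SmoothFunNear m (g.dual A B C) x := by
  unfold dual
  refine (smoothFunNear_const _).mul ?_
  refine SmoothFunNear.add (.sub (.add (.sub (.add ?_ ?_) ?_) ?_) ?_) ?_
  · exact .dirDeriv (g.smoothFunNear_form hB hC) hA
  · exact .dirDeriv (g.smoothFunNear_form hC hA) hB
  · exact .dirDeriv (g.smoothFunNear_form hA hB) hC
  · exact g.smoothFunNear_form (hA.mlieBracket hB) hC
  · exact g.smoothFunNear_form (hB.mlieBracket hC) hA
  · exact g.smoothFunNear_form (hC.mlieBracket hA) hB

/-- Compatibility of `□` with the metric; `dual_sub_dual_swap` is its freedom from torsion. These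
two identities replace the Koszul formula in most of what follows. -/
theorem dual_add_dual_swap (A B C : VField m M) (x : M) :
    g.dual A B C x + g.dual A C B x = dirDeriv (fun y ↦ g.form y (B y) (C y)) x (A x) := by
  unfold dual
  have h1 : (fun y ↦ g.form y (C y) (B y)) = fun y ↦ g.form y (B y) (C y) :=
    funext fun y ↦ g.symm _ _ _
  have h2 : (fun y ↦ g.form y (A y) (B y)) = fun y ↦ g.form y (B y) (A y) :=
    funext fun y ↦ g.symm _ _ _
  have h3 : (fun y ↦ g.form y (A y) (C y)) = fun y ↦ g.form y (C y) (A y) :=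
    funext fun y ↦ g.symm _ _ _
  rw [h1, h2, h3, mlieBracket_swap_apply (V := C) (W := B), mlieBracket_swap_apply (V := A) (W := C),
    mlieBracket_swap_apply (V := B) (W := A)]
  simp only [map_neg, neg_apply]
  ring

theorem dual_sub_dual_swap (A B C : VField m M) (x : M) :
    g.dual A B C x - g.dual B A C x = g.form x (mlieBracket (𝓡 m) A B x) (C x) := by
  unfold dual
  have h1 : (fun y ↦ g.form y (C y) (B y)) = fun y ↦ g.form y (B y) (C y) :=
    funext fun y ↦ g.symm _ _ _
  have h2 : (fun y ↦ g.form y (A y) (B y)) = fun y ↦ g.form y (B y) (A y) :=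
    funext fun y ↦ g.symm _ _ _
  have h3 : (fun y ↦ g.form y (A y) (C y)) = fun y ↦ g.form y (C y) (A y) :=
    funext fun y ↦ g.symm _ _ _
  rw [h1, h2, h3, mlieBracket_swap_apply (V := C) (W := B), mlieBracket_swap_apply (V := A) (W := C),
    mlieBracket_swap_apply (V := B) (W := A)]
  simp only [map_neg, neg_apply]
  ring

theorem tensorialAt_dual_left (hB : DiffAt B x) (hC : DiffAt C x) :
    TensorialAt (𝓡 m) (EuclideanSpace ℝ (Fin m)) (fun A ↦ g.dual A B C x) x where
  smul {f A} hf hA := by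
    have h1 : (fun y ↦ g.form y (C y) ((f • A) y)) = fun y ↦ f y * g.form y (C y) (A y) :=
      funext fun y ↦ by simp
    have h2 : (fun y ↦ g.form y ((f • A) y) (B y)) = fun y ↦ f y * g.form y (A y) (B y) :=
      funext fun y ↦ by simp
    simp only [dual, h1, h2, lie_smul_left hf hA, lie_smul_right hf hA,
      dirDeriv_mul hf (g.diffFunAt_form hC hA), dirDeriv_mul hf (g.diffFunAt_form hA hB)]
    simp only [Pi.smul_apply', map_add, map_smul, add_apply, smul_apply, dirDeriv_vsmul,
      smul_eq_mul, g.symm x (C x) (A x)]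
    ring
  add {A A'} hA hA' := by
    have h1 : (fun y ↦ g.form y (C y) ((A + A') y)) =
        fun y ↦ g.form y (C y) (A y) + g.form y (C y) (A' y) :=
      funext fun y ↦ by simp
    have h2 : (fun y ↦ g.form y ((A + A') y) (B y)) =
        fun y ↦ g.form y (A y) (B y) + g.form y (A' y) (B y) :=
      funext fun y ↦ by simp
    simp only [dual, h1, h2, mlieBracket_add_left hA hA', mlieBracket_add_right hA hA',
      dirDeriv_add (g.diffFunAt_form hC hA) (g.diffFunAt_form hC hA'),
      dirDeriv_add (g.diffFunAt_form hA hB) (g.diffFunAt_form hA' hB)]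
    simp only [Pi.add_apply, map_add, add_apply, dirDeriv_vadd]
    ring

/-- Trades the third slot for the first, so that tensoriality in `C` follows from tensoriality on
the left: the derivatives of a factor of `C` coming from `B⟨A,C⟩` and from `⟨[B,C],A⟩` cancel. -/
theorem dual_left_eq (A B C : VField m M) (x : M) : g.dual A B C x =
    dirDeriv (fun y ↦ g.form y (A y) (C y)) x (B x) - g.dual C B A x
      - g.form x (mlieBracket (𝓡 m) B C x) (A x) + g.form x (mlieBracket (𝓡 m) A B x) (C x) := by
  have h1 := g.dual_sub_dual_swap A B C x
  have h2 := g.dual_add_dual_swap B A C x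
  have h3 := g.dual_sub_dual_swap B C A x
  linarith

theorem tensorialAt_dual_right (hA : DiffAt A x) (hB : DiffAt B x) :
    TensorialAt (𝓡 m) (EuclideanSpace ℝ (Fin m)) (fun C ↦ g.dual A B C x) x where
  smul {f C} hf hC := by
    have h1 : (fun y ↦ g.form y (A y) ((f • C) y)) = fun y ↦ f y * g.form y (A y) (C y) :=
      funext fun y ↦ by simp
    rw [g.dual_left_eq A B (f • C), g.dual_left_eq A B C, h1, lie_smul_right hf hC,
      dirDeriv_mul hf (g.diffFunAt_form hA hC), (g.tensorialAt_dual_left hB hA).smul hf hC]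
    simp only [Pi.smul_apply', map_add, map_smul, add_apply, smul_apply,
      smul_eq_mul, g.symm x (C x) (A x)]
    ring
  add {C C'} hC hC' := by
    have h1 : (fun y ↦ g.form y (A y) ((C + C') y)) =
        fun y ↦ g.form y (A y) (C y) + g.form y (A y) (C' y) :=
      funext fun y ↦ by simp
    rw [g.dual_left_eq A B (C + C'), g.dual_left_eq A B C, g.dual_left_eq A B C', h1,
      mlieBracket_add_right hC hC', dirDeriv_add (g.diffFunAt_form hA hC) (g.diffFunAt_form hA hC'),
      (g.tensorialAt_dual_left hB hA).add hC hC']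
    simp only [Pi.add_apply, map_add, add_apply]
    ring

theorem dual_congr_left {A' : VField m M} (hA : DiffAt A x) (hA' : DiffAt A' x) (hB : DiffAt B x)
    (hC : DiffAt C x) (h : A x = A' x) : g.dual A B C x = g.dual A' B C x :=
  (g.tensorialAt_dual_left hB hC).pointwise hA hA' h

theorem dual_congr_right {C' : VField m M} (hA : DiffAt A x) (hB : DiffAt B x) (hC : DiffAt C x)
    (hC' : DiffAt C' x) (h : C x = C' x) : g.dual A B C x = g.dual A B C' x :=
  (g.tensorialAt_dual_right hA hB).pointwise hC hC' h

theorem dual_smul_mid (hA : DiffAt A x) (hf : DiffFunAt m f x) (hB : DiffAt B x)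
    (hC : DiffAt C x) : g.dual A (f • B) C x =
      f x * g.dual A B C x + dirDeriv f x (A x) * g.form x (B x) (C x) := by
  have h1 := g.dual_add_dual_swap A (f • B) C x
  have h2 := g.dual_add_dual_swap A B C x
  have h3 : (fun y ↦ g.form y ((f • B) y) (C y)) = fun y ↦ f y * g.form y (B y) (C y) :=
    funext fun y ↦ by simp
  rw [(g.tensorialAt_dual_right hA hC).smul hf hB, h3,
    dirDeriv_mul hf (g.diffFunAt_form hB hC), ← h2, smul_eq_mul] at h1
  linarith

theorem dual_add_mid {B' : VField m M} (hA : DiffAt A x) (hB : DiffAt B x) (hB' : DiffAt B' x)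
    (hC : DiffAt C x) : g.dual A (B + B') C x = g.dual A B C x + g.dual A B' C x := by
  have h1 := g.dual_add_dual_swap A (B + B') C x
  have h2 := g.dual_add_dual_swap A B C x
  have h2' := g.dual_add_dual_swap A B' C x
  have h3 : (fun y ↦ g.form y ((B + B') y) (C y)) =
      fun y ↦ g.form y (B y) (C y) + g.form y (B' y) (C y) :=
    funext fun y ↦ by simp
  rw [(g.tensorialAt_dual_right hA hC).add hB hB', h3,
    dirDeriv_add (g.diffFunAt_form hB hC) (g.diffFunAt_form hB' hC)] at h1
  linarith

theorem dual_congr_mid {B' : VField m M} (h : B =ᶠ[𝓝 x] B') :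
    g.dual A B C x = g.dual A B' C x := by
  have h1 := h.self_of_nhds
  unfold dual
  rw [lie_congr_right h, lie_congr_left h, h1,
    dirDeriv_congr (f := fun y ↦ g.form y (B y) (C y)) (h := fun y ↦ g.form y (B' y) (C y))
      (by filter_upwards [h] with y hy; rw [hy]),
    dirDeriv_congr (f := fun y ↦ g.form y (A y) (B y)) (h := fun y ↦ g.form y (A y) (B' y))
      (by filter_upwards [h] with y hy; rw [hy])]

end SymTensor

end RiemannLorentz

/-! ### Coordinate frames. -/

namespace RiemannLorentz

variable {m : ℕ} {M : Type*} [TopologicalSpace M] [ChartedSpace (EuclideanSpace ℝ (Fin m)) M]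
  [IsManifold (𝓡 m) ∞ M]

section Frame

variable {A : VField m M} {p x : M}

/-- The coordinate frame of the preferred chart at `p`. -/
noncomputable def frame (p : M) : Fin m → VField m M :=
  (trivializationAt (EuclideanSpace ℝ (Fin m)) (TangentSpace (𝓡 m)) p).localFrame
    (EuclideanSpace.basisFun (Fin m) ℝ).toBasis

/-- The components of a tangent vector in the coordinate frame of the preferred chart at `p`. -/
noncomputable def frameCoeff (p : M) (a : Fin m) (x : M) : TangentSpace (𝓡 m) x →ₗ[ℝ] ℝ :=
  (trivializationAt (EuclideanSpace ℝ (Fin m)) (TangentSpace (𝓡 m)) p).localFrameCoeff (𝓡 m)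
    (EuclideanSpace.basisFun (Fin m) ℝ).toBasis a x

theorem smoothNear_frame (hx : x ∈ (chartAt (EuclideanSpace ℝ (Fin m)) p).source) (a : Fin m) :
    SmoothNear (frame p a) x := by
  filter_upwards [(chartAt (EuclideanSpace ℝ (Fin m)) p).open_source.mem_nhds hx] with y hy
  exact contMDiffAt_localFrame_of_mem ∞ _ _ a (by simpa using hy)

theorem SmoothNear.frameCoeff (hA : SmoothNear A x)
    (hx : x ∈ (chartAt (EuclideanSpace ℝ (Fin m)) p).source) (a : Fin m) :
    SmoothFunNear m (fun y ↦ frameCoeff p a y (A y)) x := by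
  filter_upwards [hA, (chartAt (EuclideanSpace ℝ (Fin m)) p).open_source.mem_nhds hx] with y h1 hy
  exact contMDiffAt_localFrameCoeff _ (by simpa using hy) h1 a

theorem sum_frameCoeff_smul_frame (hx : x ∈ (chartAt (EuclideanSpace ℝ (Fin m)) p).source)
    (v : TangentSpace (𝓡 m) x) : ∑ a, frameCoeff p a x v • frame p a x = v := by
  classical
  have := Bundle.Trivialization.eq_sum_localFrameCoeff_smul (I := 𝓡 m)
    (e := trivializationAt (EuclideanSpace ℝ (Fin m)) (TangentSpace (𝓡 m)) p)
    (b := (EuclideanSpace.basisFun (Fin m) ℝ).toBasis) (s := Function.update 0 x v) (x' := x)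
    (by simpa using hx)
  rw [Function.update_self] at this
  exact this.symm

theorem frameCoeff_sum_smul_frame (hx : x ∈ (chartAt (EuclideanSpace ℝ (Fin m)) p).source)
    (c : Fin m → ℝ) (a : Fin m) : frameCoeff p a x (∑ b, c b • frame p b x) = c a := by
  classical
  have hx' : x ∈ (trivializationAt (EuclideanSpace ℝ (Fin m))
    (TangentSpace (𝓡 m)) p).baseSet := by simpa using hx
  have h1 : ∀ b, frame p b x = (trivializationAt (EuclideanSpace ℝ (Fin m))
      (TangentSpace (𝓡 m)) p).basisAt (EuclideanSpace.basisFun (Fin m) ℝ).toBasis hx' b := fun b ↦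
    Bundle.Trivialization.localFrame_apply_of_mem_baseSet _ _ hx'
  have h2 := Bundle.Trivialization.localFrameCoeff_apply_of_mem_baseSet (I := 𝓡 m)
    (trivializationAt (EuclideanSpace ℝ (Fin m)) (TangentSpace (𝓡 m)) p)
    (EuclideanSpace.basisFun (Fin m) ℝ).toBasis hx'
    (Function.update 0 x (∑ b, c b • frame p b x)) a
  rw [Function.update_self] at h2
  refine h2.trans ?_
  simp [h1, Finsupp.single_apply]

/-- Links the coordinate fields of the transversality hypothesis with the local frame of the tangent
bundle, for which components and their smoothness are available. -/
theorem coordField_chartAt (hx : x ∈ (chartAt (EuclideanSpace ℝ (Fin m)) p).source) (a : Fin m) :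
    coordField (chartAt (EuclideanSpace ℝ (Fin m)) p) a x = frame p a x := by
  have hx' : x ∈ (trivializationAt (EuclideanSpace ℝ (Fin m))
    (TangentSpace (𝓡 m)) p).baseSet := by simpa using hx
  have h1 : frame p a x = (trivializationAt (EuclideanSpace ℝ (Fin m))
      (TangentSpace (𝓡 m)) p).basisAt (EuclideanSpace.basisFun (Fin m) ℝ).toBasis hx' a :=
    Bundle.Trivialization.localFrame_apply_of_mem_baseSet _ _ hx'
  let φ : TangentSpace (𝓡 m) x →L[ℝ] EuclideanSpace ℝ (Fin m) :=
    mfderiv (𝓡 m) (𝓡 m) (chartAt (EuclideanSpace ℝ (Fin m)) p) x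
  have h2 : φ = ((trivializationAt (EuclideanSpace ℝ (Fin m))
      (TangentSpace (𝓡 m)) p).continuousLinearEquivAt ℝ x hx' :
        TangentSpace (𝓡 m) x →L[ℝ] EuclideanSpace ℝ (Fin m)) := by
    refine Eq.trans (TangentBundle.continuousLinearMapAt_trivializationAt
      (I := 𝓡 m) hx).symm ?_
    ext1 v
    simp [Bundle.Trivialization.coe_linearMapAt_of_mem _ hx']
  have h3 : coordField (chartAt (EuclideanSpace ℝ (Fin m)) p) a x =
      φ.inverse (EuclideanSpace.single a 1) := rfl
  rw [h1, h3, h2, ContinuousLinearMap.inverse_equiv]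
  simp only [Bundle.Trivialization.basisAt, Module.Basis.map_apply, OrthonormalBasis.coe_toBasis,
    EuclideanSpace.basisFun_apply]
  rfl

end Frame

end RiemannLorentz

/-! ### The Gram determinant as a defining function of `Σ`; the radical is a line. -/

namespace RiemannLorentz

section Functions

variable {m : ℕ} {M : Type*} [TopologicalSpace M] [ChartedSpace (EuclideanSpace ℝ (Fin m)) M]
  {f τ : M → ℝ} {p x : M}

theorem SmoothFunNear.det {G : M → Matrix (Fin m) (Fin m) ℝ}
    (hG : ∀ a b, SmoothFunNear m (fun y ↦ G y a b) x) : SmoothFunNear m (fun y ↦ (G y).det) x := by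
  simp only [Matrix.det_apply']
  exact .sum fun σ _ ↦ (smoothFunNear_const _).mul (.prod fun i _ ↦ hG _ _)

theorem SmoothFunNear.adjugate {G : M → Matrix (Fin m) (Fin m) ℝ}
    (hG : ∀ a b, SmoothFunNear m (fun y ↦ G y a b) x) (a b : Fin m) :
    SmoothFunNear m (fun y ↦ (G y).adjugate a b) x := by
  simp only [Matrix.adjugate_apply]
  refine .det fun i j ↦ ?_
  by_cases h : i = b
  · subst h
    simpa using smoothFunNear_const _
  · simpa [h] using hG i j

theorem exists_dirDeriv_ne_zero (hτ : mfderiv (𝓡 m) 𝓘(ℝ, ℝ) τ x ≠ 0) :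
    ∃ v : TangentSpace (𝓡 m) x, dirDeriv τ x v ≠ 0 := by
  by_contra! h
  exact hτ (ContinuousLinearMap.ext h)

theorem dirDeriv_mul_of_eq_zero {h : M → ℝ} (hf : DiffFunAt m f x) (hh : DiffFunAt m h x)
    (hf0 : f x = 0) (hh0 : h x = 0) (v : TangentSpace (𝓡 m) x) :
    dirDeriv (fun y ↦ f y * h y) x v = 0 := by
  rw [dirDeriv_mul hf hh, hf0, hh0]
  simp

end Functions

variable {m : ℕ} {M : Type*} [TopologicalSpace M] [ChartedSpace (EuclideanSpace ℝ (Fin m)) M]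
  [IsManifold (𝓡 m) ∞ M]

/-- At a zero of `τ` this is Hadamard's lemma read in a chart; elsewhere `h = f / τ`. The
nondegeneracy condition is conditional so that points on and off `Σ` are treated alike. -/
theorem exists_mul_of_eq_zero {f τ : M → ℝ} {p : M} (hf : SmoothFunNear m f p)
    (hτ : SmoothFunNear m τ p) (hd : τ p = 0 → mfderiv (𝓡 m) 𝓘(ℝ, ℝ) τ p ≠ 0)
    (h0 : ∀ᶠ x in 𝓝 p, τ x = 0 → f x = 0) :
    ∃ h : M → ℝ, SmoothFunNear m h p ∧ ∀ᶠ x in 𝓝 p, f x = τ x * h x := by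
  by_cases hp : τ p = 0
  · set e := chartAt (EuclideanSpace ℝ (Fin m)) p with he
    have hpe : p ∈ e.source := mem_chart_source _ p
    have hback : Filter.Tendsto e.symm (𝓝 (e p)) (𝓝 p) := e.tendsto_symm hpe
    have htgt := e.open_target.mem_nhds (e.map_source hpe)
    have sm : ∀ {k : M → ℝ}, SmoothFunNear m k p →
        ∀ᶠ y in 𝓝 (e p), ContDiffAt ℝ ∞ (k ∘ e.symm) y := fun {k} hk ↦ by
      filter_upwards [hback.eventually hk, htgt] with y h1 h2
      rw [← contMDiffAt_iff_contDiffAt]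
      exact h1.comp y ((contMDiffOn_chart_symm (I := 𝓡 m) (n := ∞) (x := p)).contMDiffAt
        (e.open_target.mem_nhds h2))
    have hde : fderiv ℝ (τ ∘ e.symm) (e p) ≠ 0 := by
      intro h
      apply hd hp
      have h1 : τ =ᶠ[𝓝 p] (τ ∘ e.symm) ∘ e := by
        filter_upwards [e.open_source.mem_nhds hpe] with x hx
        simp [e.left_inv hx]
      have h2 : MDifferentiableAt (𝓡 m) (𝓡 m) e p :=
        (contMDiffAt_of_mem_maximalAtlas (n := ∞) (IsManifold.chart_mem_maximalAtlas p)
          hpe).mdifferentiableAt (by simp)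
      have h3 : MDifferentiableAt (𝓡 m) 𝓘(ℝ, ℝ) (τ ∘ e.symm) (e p) :=
        ((sm hτ).self_of_nhds.differentiableAt (by simp)).mdifferentiableAt
      ext v
      rw [h1.mfderiv_eq, mfderiv_comp p h3 h2, mfderiv_eq_fderiv, h]
      rfl
    obtain ⟨h, hh, hfh⟩ := eventually_exists_mul_of_fderiv_ne_zero (sm hf) (sm hτ) hde (by
      filter_upwards [hback.eventually h0] with y hy using hy)
    have hto : Filter.Tendsto e (𝓝 p) (𝓝 (e p)) := e.continuousAt hpe
    refine ⟨h ∘ e, ?_, ?_⟩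
    · filter_upwards [hto.eventually hh, e.open_source.mem_nhds hpe] with x h1 h2
      exact (contMDiffAt_iff_contDiffAt.2 h1).comp x
        (contMDiffAt_of_mem_maximalAtlas (n := ∞) (IsManifold.chart_mem_maximalAtlas p) h2)
    · filter_upwards [hto.eventually hfh, e.open_source.mem_nhds hpe] with x h1 h2
      simpa [e.left_inv h2] using h1
  · have hne : ∀ᶠ x in 𝓝 p, τ x ≠ 0 := hτ.self_of_nhds.continuousAt.eventually_ne hp
    refine ⟨fun x ↦ f x / τ x, ?_, ?_⟩
    · filter_upwards [hf, hτ, hne] with x h1 h2 h3 using h1.div₀ h2 h3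
    · filter_upwards [hne] with x h3
      field_simp

namespace SymTensor

variable (g : SymTensor m M) {A B C : VField m M} {p x : M}

/-- The matrix of `g` in the coordinate frame of the preferred chart at `p`. -/
noncomputable def gram (p x : M) : Matrix (Fin m) (Fin m) ℝ :=
  Matrix.of fun a b ↦ g.form x (frame p a x) (frame p b x)

theorem smoothFunNear_gram (hx : x ∈ (chartAt (EuclideanSpace ℝ (Fin m)) p).source) (a b : Fin m) :
    SmoothFunNear m (fun y ↦ g.gram p y a b) x :=
  g.smoothFunNear_form (smoothNear_frame hx a) (smoothNear_frame hx b)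

theorem smoothFunNear_det_gram (hx : x ∈ (chartAt (EuclideanSpace ℝ (Fin m)) p).source) :
    SmoothFunNear m (fun y ↦ (g.gram p y).det) x :=
  .det (g.smoothFunNear_gram hx)

theorem coordDet_eventuallyEq (hx : x ∈ (chartAt (EuclideanSpace ℝ (Fin m)) p).source) :
    g.coordDet (chartAt (EuclideanSpace ℝ (Fin m)) p) =ᶠ[𝓝 x] fun y ↦ (g.gram p y).det := by
  filter_upwards [(chartAt (EuclideanSpace ℝ (Fin m)) p).open_source.mem_nhds hx] with y hy
  simp only [coordDet, gram, coordField_chartAt hy]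

theorem form_sum_frame (c : Fin m → ℝ) (b : Fin m) :
    g.form x (∑ a, c a • frame p a x) (frame p b x) = (g.gram p x).mulVec c b := by
  simp only [map_sum, map_smul, sum_apply, smul_apply, smul_eq_mul,
    Matrix.mulVec, dotProduct, gram, Matrix.of_apply]
  refine Finset.sum_congr rfl fun a _ ↦ ?_
  rw [g.symm x (frame p b x), mul_comm]

theorem isRadical_iff_frame (hx : x ∈ (chartAt (EuclideanSpace ℝ (Fin m)) p).source)
    (v : TangentSpace (𝓡 m) x) : g.IsRadical x v ↔ ∀ b, g.form x v (frame p b x) = 0 := by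
  refine ⟨fun h b ↦ h _, fun h w ↦ ?_⟩
  rw [← sum_frameCoeff_smul_frame hx w]
  simp [h]

theorem isRadical_sum_frame (hx : x ∈ (chartAt (EuclideanSpace ℝ (Fin m)) p).source)
    (c : Fin m → ℝ) : g.IsRadical x (∑ a, c a • frame p a x) ↔ (g.gram p x).mulVec c = 0 := by
  rw [g.isRadical_iff_frame hx]
  simp only [form_sum_frame, funext_iff, Pi.zero_apply]

theorem mem_sing_iff (hx : x ∈ (chartAt (EuclideanSpace ℝ (Fin m)) p).source) :
    x ∈ g.sing ↔ (g.gram p x).det = 0 := by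
  rw [← Matrix.exists_mulVec_eq_zero_iff]
  constructor
  · rintro ⟨v, hv, hrad⟩
    rw [← sum_frameCoeff_smul_frame hx v] at hv hrad
    refine ⟨fun a ↦ frameCoeff p a x v, fun h ↦ hv ?_, (g.isRadical_sum_frame hx _).1 hrad⟩
    have h' : ∀ a, frameCoeff p a x v = 0 := fun a ↦ congrFun h a
    simp [h']
  · rintro ⟨c, hc, hG⟩
    refine ⟨∑ a, c a • frame p a x, fun h ↦ hc ?_, (g.isRadical_sum_frame hx _).2 hG⟩
    funext a
    rw [← frameCoeff_sum_smul_frame hx c a, h]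
    simp

theorem isClosed_sing : IsClosed g.sing := by
  rw [← isOpen_compl_iff, isOpen_iff_eventually]
  intro p hp
  have hps := mem_chart_source (EuclideanSpace ℝ (Fin m)) p
  have h1 := (g.mem_sing_iff hps).not.1 hp
  filter_upwards [(g.smoothFunNear_det_gram hps).self_of_nhds.continuousAt.eventually_ne h1,
    (chartAt (EuclideanSpace ℝ (Fin m)) p).open_source.mem_nhds hps] with x h2 h3
  exact (g.mem_sing_iff h3).not.2 h2

variable {g}

theorem IsTransverseRiemannLorentz.mfderiv_det_gram_ne_zero (hg : g.IsTransverseRiemannLorentz)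
    (hx : x ∈ (chartAt (EuclideanSpace ℝ (Fin m)) p).source) (hxs : x ∈ g.sing) :
    mfderiv (𝓡 m) 𝓘(ℝ, ℝ) (fun y ↦ (g.gram p y).det) x ≠ 0 := by
  have := hg.transverse _ (IsManifold.chart_mem_maximalAtlas p) x ⟨hxs, hx⟩
  rwa [(g.coordDet_eventuallyEq hx).mfderiv_eq] at this

/-- Two continuous functions which agree outside `Σ` agree on `Σ`. -/
theorem IsTransverseRiemannLorentz.eq_of_eq_off_sing (hg : g.IsTransverseRiemannLorentz)
    {f h : M → ℝ} (hf : ContinuousAt f p) (hh : ContinuousAt h p)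
    (hfh : ∀ᶠ x in 𝓝 p, x ∉ g.sing → f x = h x) : f p = h p := by
  by_cases hp : p ∈ g.sing
  · by_contra hne
    -- Different values at `p` would put a whole neighbourhood of `p` inside `Σ`, yet Riemannian
    -- points, which are nondegenerate, accumulate at `p`.
    have h1 : ∀ᶠ x in 𝓝 p, x ∈ g.sing := by
      have h2 := (hf.sub hh).eventually_ne (sub_ne_zero.2 hne)
      filter_upwards [h2, hfh] with x h3 h4
      by_contra h5
      exact h3 (sub_eq_zero.2 (h4 h5))
    obtain ⟨x, h2, v, hv, hrad⟩ := (mem_closure_iff_frequently.1 (hg.changes p hp).1).and_eventually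
      h1 |>.exists
    exact (h2 v hv).ne' (hrad v)
  · exact hfh.self_of_nhds hp

/-- Two independent kernel vectors have, for each `i`, a nonzero combination `w` with `w i = 0`. It
is still killed after any row is replaced by the `i`-th unit row, so all cofactors vanish. -/
theorem exists_smul_of_mulVec_eq_zero {G : Matrix (Fin m) (Fin m) ℝ} (hG : G.adjugate ≠ 0)
    {u v : Fin m → ℝ} (hu : G.mulVec u = 0) (hv : G.mulVec v = 0) (hv0 : v ≠ 0) :
    ∃ c : ℝ, u = c • v := by
  by_contra! H
  apply hG
  ext i j
  rw [Matrix.adjugate_apply, Matrix.zero_apply, ← Matrix.exists_mulVec_eq_zero_iff]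
  obtain ⟨w, hw0, hwi, hGw⟩ : ∃ w : Fin m → ℝ, w ≠ 0 ∧ w i = 0 ∧ G.mulVec w = 0 := by
    by_cases hvi : v i = 0
    · exact ⟨v, hv0, hvi, hv⟩
    · refine ⟨u - (u i / v i) • v, fun h ↦ H _ (sub_eq_zero.1 h), ?_, ?_⟩
      · simp [hvi]
      · rw [Matrix.mulVec_sub, Matrix.mulVec_smul, hu, hv]
        simp
  refine ⟨w, hw0, funext fun k ↦ ?_⟩
  by_cases hk : k = j
  · subst hk
    simp [Matrix.mulVec, hwi]
  · simpa [Matrix.mulVec, hk] using congrFun hGw k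

/-- If the adjugate vanished at `x`, the determinant would vanish there to second order: with `v` in
the kernel at `x`, `det G • v = (v G) adj(G)` is a product of two factors vanishing at `x`. This
contradicts transversality. -/
theorem IsTransverseRiemannLorentz.adjugate_gram_ne_zero (hg : g.IsTransverseRiemannLorentz)
    (hx : x ∈ (chartAt (EuclideanSpace ℝ (Fin m)) p).source) (hxs : x ∈ g.sing) :
    (g.gram p x).adjugate ≠ 0 := by
  intro h0
  obtain ⟨w, hw⟩ := exists_dirDeriv_ne_zero (hg.mfderiv_det_gram_ne_zero hx hxs)
  obtain ⟨v, hv0, hv⟩ := Matrix.exists_mulVec_eq_zero_iff.2 ((g.mem_sing_iff hx).1 hxs)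
  have hv' : Matrix.vecMul v (g.gram p x) = 0 := by
    rw [← Matrix.mulVec_transpose, show (g.gram p x).transpose = g.gram p x from ?_, hv]
    ext a b
    exact g.symm _ _ _
  apply hv0
  funext j
  have hG := g.smoothFunNear_gram hx
  have h1 : ∀ k, SmoothFunNear m (fun y ↦ Matrix.vecMul v (g.gram p y) k) x := fun k ↦ by
    simp only [Matrix.vecMul, dotProduct]
    exact .sum fun i _ ↦ (smoothFunNear_const _).mul (hG i k)
  have h2 : ∀ k, SmoothFunNear m (fun y ↦ (g.gram p y).adjugate k j) x := fun k ↦ .adjugate hG k j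
  have h3 : (fun y ↦ (g.gram p y).det * v j) = fun y ↦ ∑ k,
      Matrix.vecMul v (g.gram p y) k * (g.gram p y).adjugate k j := funext fun y ↦ by
    have := congrFun (Matrix.vecMul_vecMul v (g.gram p y) (g.gram p y).adjugate) j
    rw [Matrix.mul_adjugate, Matrix.vecMul_smul, Matrix.vecMul_one] at this
    exact this.symm
  have h4 : dirDeriv (fun y ↦ (g.gram p y).det * v j) x w = 0 := by
    rw [h3, dirDeriv_sum fun k _ ↦ ((h1 k).mul (h2 k)).diffFunAt]
    refine Finset.sum_eq_zero fun k _ ↦ ?_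
    exact dirDeriv_mul_of_eq_zero (h1 k).diffFunAt (h2 k).diffFunAt (congrFun hv' k)
      (by rw [h0]; rfl) w
  rw [dirDeriv_mul (g.smoothFunNear_det_gram hx).diffFunAt (smoothFunNear_const _).diffFunAt,
    dirDeriv_const, mul_zero, zero_add] at h4
  exact (mul_eq_zero.1 h4).resolve_left hw

/-- The radical is a line at each point of `Σ`. -/
theorem IsTransverseRiemannLorentz.exists_smul_of_isRadical (hg : g.IsTransverseRiemannLorentz)
    (hxs : x ∈ g.sing) {u v : TangentSpace (𝓡 m) x} (hu : g.IsRadical x u) (hv : g.IsRadical x v)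
    (hv0 : v ≠ 0) : ∃ c : ℝ, u = c • v := by
  have hx := mem_chart_source (EuclideanSpace ℝ (Fin m)) x
  rw [← sum_frameCoeff_smul_frame hx u] at hu
  rw [← sum_frameCoeff_smul_frame hx v] at hv
  obtain ⟨c, hc⟩ := exists_smul_of_mulVec_eq_zero (hg.adjugate_gram_ne_zero hx hxs)
    ((g.isRadical_sum_frame hx _).1 hu) ((g.isRadical_sum_frame hx _).1 hv) (fun h ↦ hv0 (by
      have h' : ∀ a, frameCoeff x a x v = 0 := fun a ↦ congrFun h a
      rw [← sum_frameCoeff_smul_frame hx v]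
      simp [h']))
  refine ⟨c, ?_⟩
  rw [← sum_frameCoeff_smul_frame hx u, ← sum_frameCoeff_smul_frame hx v, Finset.smul_sum]
  refine Finset.sum_congr rfl fun a _ ↦ ?_
  rw [smul_smul]
  exact congrArg (· • _) (congrFun hc a)

end SymTensor

end RiemannLorentz

/-! ### Smooth fields representing the dual derivative across `Σ`. -/

namespace RiemannLorentz

variable {m : ℕ} {M : Type*} [TopologicalSpace M] [ChartedSpace (EuclideanSpace ℝ (Fin m)) M]
  [IsManifold (𝓡 m) ∞ M]

namespace SymTensor

variable (g : SymTensor m M) {A B C F G : VField m M} {p x : M}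

/-- The value of `F` at `x` represents the dual derivative `□_A B` at `x`. -/
def Represents (F A B : VField m M) (x : M) : Prop :=
  ∀ C : VField m M, DiffAt C x → g.form x (F x) (C x) = g.dual A B C x

variable {g}

theorem dual_eq_sum_frame (hA : DiffAt A x) (hB : DiffAt B x) (hC : DiffAt C x)
    (hx : x ∈ (chartAt (EuclideanSpace ℝ (Fin m)) p).source) :
    g.dual A B C x = ∑ a, frameCoeff p a x (C x) * g.dual A B (frame p a) x := by
  have hT := g.tensorialAt_dual_right hA hB
  have hfr : ∀ a, DiffAt (frame p a) x := fun a ↦ (smoothNear_frame hx a).diffAt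
  have hs : ∀ a, DiffAt ((fun _ ↦ frameCoeff p a x (C x)) • frame p a) x := fun a ↦
    ((smoothNear_frame hx a).smul (smoothFunNear_const _)).diffAt
  rw [g.dual_congr_right hA hB hC (C' := fun y ↦ ∑ a, ((fun _ ↦ frameCoeff p a x (C x)) •
    frame p a) y) (MDifferentiableAt.sum_section fun a _ ↦ hs a)
    (sum_frameCoeff_smul_frame hx (C x)).symm, hT.sum _ (fun a _ ↦ hs a)]
  refine Finset.sum_congr rfl fun a _ ↦ ?_
  exact hT.smul mdifferentiableAt_const (hfr a)

theorem represents_iff_frame (hA : DiffAt A x) (hB : DiffAt B x)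
    (hx : x ∈ (chartAt (EuclideanSpace ℝ (Fin m)) p).source) :
    g.Represents F A B x ↔ ∀ b, g.form x (F x) (frame p b x) = g.dual A B (frame p b) x := by
  refine ⟨fun h b ↦ h _ (smoothNear_frame hx b).diffAt, fun h C hC ↦ ?_⟩
  rw [dual_eq_sum_frame hA hB hC hx]
  conv_lhs => rw [← sum_frameCoeff_smul_frame hx (C x)]
  simp [h]

/-- The dual derivative `□_A B` is represented by a smooth field near `p` as soon as it vanishes on
the radical. -/
theorem IsTransverseRiemannLorentz.exists_represents (hg : g.IsTransverseRiemannLorentz)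
    (hA : SmoothNear A p) (hB : SmoothNear B p)
    (hrad : ∀ᶠ x in 𝓝 p, x ∈ g.sing → ∀ C : VField m M, DiffAt C x → g.IsRadical x (C x) →
      g.dual A B C x = 0) :
    ∃ F : VField m M, SmoothNear F p ∧ ∀ᶠ x in 𝓝 p, g.Represents F A B x := by
  have hps := mem_chart_source (EuclideanSpace ℝ (Fin m)) p
  have hsrc := (chartAt (EuclideanSpace ℝ (Fin m)) p).open_source.mem_nhds hps
  have hb : ∀ b, SmoothFunNear m (g.dual A B (frame p b)) p := fun b ↦
    g.smoothFunNear_dual hA hB (smoothNear_frame hps b)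
  -- Numerators in Cramer's rule: the components of the field sought, multiplied by `det G`.
  let c : Fin m → M → ℝ := fun a y ↦
    (g.gram p y).adjugate.mulVec (fun b ↦ g.dual A B (frame p b) y) a
  have hc : ∀ a, SmoothFunNear m (c a) p := fun a ↦ by
    simp only [c, Matrix.mulVec, dotProduct]
    exact .sum fun b _ ↦ (SmoothFunNear.adjugate (g.smoothFunNear_gram hps) a b).mul (hb b)
  have hc0 : ∀ a, ∀ᶠ x in 𝓝 p, (g.gram p x).det = 0 → c a x = 0 := fun a ↦ by
    filter_upwards [hrad, hsrc, hA.eventually, hB.eventually] with x h1 hx h2 h3 hdet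
    -- At a singular point each row of `adj(G)` gives a radical vector, because `adj(G) G = det G •
    -- 1 = 0` and `G` is symmetric. The component `c a` is the value of `□_A B` on that vector.
    let C : VField m M := fun y ↦ ∑ b, (g.gram p x).adjugate a b • frame p b y
    have hC : DiffAt C x := (SmoothNear.sum fun b _ ↦
      (smoothNear_frame hx b).smul (smoothFunNear_const ((g.gram p x).adjugate a b))).diffAt
    have hCr : g.IsRadical x (C x) := by
      refine (g.isRadical_sum_frame hx _).2 ?_
      have h4 : (g.gram p x).transpose = g.gram p x := by
        ext i j
        exact g.symm _ _ _
      have h5 := congrFun (Matrix.adjugate_mul (g.gram p x)) a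
      rw [hdet, zero_smul] at h5
      have h6 : (g.gram p x).mulVec ((g.gram p x).adjugate a) =
          Matrix.vecMul ((g.gram p x).adjugate a) (g.gram p x) := by
        rw [← Matrix.mulVec_transpose, h4]
      exact h6.trans h5
    have h4 := h1 ((g.mem_sing_iff hx).2 hdet) C hC hCr
    rw [dual_eq_sum_frame h2.diffAt h3.diffAt hC hx] at h4
    simp only [C, frameCoeff_sum_smul_frame hx] at h4
    exact h4
  choose w hw hcw using fun a ↦ exists_mul_of_eq_zero (hc a) (g.smoothFunNear_det_gram hps)
    (fun h ↦ hg.mfderiv_det_gram_ne_zero hps ((g.mem_sing_iff hps).2 h)) (hc0 a)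
  let F : VField m M := fun y ↦ ∑ a, w a y • frame p a y
  have hF : SmoothNear F p := SmoothNear.sum fun a _ ↦ (smoothNear_frame hps a).smul (hw a)
  have hoff : ∀ᶠ x in 𝓝 p, x ∉ g.sing → ∀ b,
      g.form x (F x) (frame p b x) = g.dual A B (frame p b) x := by
    filter_upwards [hsrc, Filter.eventually_all.2 hcw] with x hx h1 hxs b
    have hdet := (g.mem_sing_iff hx).not.1 hxs
    rw [g.form_sum_frame]
    refine mul_left_cancel₀ hdet ?_
    have h2 : (g.gram p x).det • (fun a ↦ w a x) =
        (g.gram p x).adjugate.mulVec (fun b ↦ g.dual A B (frame p b) x) :=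
      funext fun a ↦ (h1 a).symm
    have h3 := congrArg (fun u ↦ (g.gram p x).mulVec u b) h2
    simpa only [Matrix.mulVec_mulVec, Matrix.mul_adjugate, Matrix.mulVec_smul, Matrix.smul_mulVec,
      Matrix.one_mulVec, Pi.smul_apply, smul_eq_mul] using h3
  refine ⟨F, hF, ?_⟩
  filter_upwards [hsrc, hoff.eventually_nhds, hA.eventually, hB.eventually, hF.eventually]
    with x hx h1 h2 h3 h4
  refine (represents_iff_frame h2.diffAt h3.diffAt hx).2 fun b ↦ ?_
  -- On `Σ` the division by `det G` says nothing; the identity passes to `Σ` by continuity.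
  refine hg.eq_of_eq_off_sing (p := x)
    (g.smoothFunNear_form h4 (smoothNear_frame hx b)).diffFunAt.continuousAt
    (g.smoothFunNear_dual h2 h3 (smoothNear_frame hx b)).diffFunAt.continuousAt ?_
  filter_upwards [h1] with y hy hys using hy hys b

theorem IsTransverseRiemannLorentz.exists_represents_off_sing (hg : g.IsTransverseRiemannLorentz)
    (hA : SmoothNear A p) (hB : SmoothNear B p) (hp : p ∉ g.sing) :
    ∃ F : VField m M, SmoothNear F p ∧ ∀ᶠ x in 𝓝 p, g.Represents F A B x := by
  refine hg.exists_represents hA hB ?_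
  filter_upwards [g.isClosed_sing.isOpen_compl.mem_nhds hp] with x hx hx'
  exact absurd hx' hx

/-- Two vectors representing the same functional differ by a radical vector, which is zero off `Σ`;
hence the chosen value is `F x`. -/
theorem nabla_eq (hF : g.Represents F A B x) (hx : x ∉ g.sing) : g.nabla A B x = F x := by
  have hw := Classical.epsilon_spec (p := fun w : TangentSpace (𝓡 m) x ↦
    ∀ V : Set M, IsOpen V → x ∈ V → ∀ C : VField m M, SmoothOn C V →
      g.form x w (C x) = g.dual A B C x)
    ⟨F x, fun V hV hxV C hC ↦ hF C (hC.smoothNear hV hxV).diffAt⟩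
  by_contra hne
  refine hx ⟨g.nabla A B x - F x, sub_ne_zero.2 hne, ?_⟩
  have hxs := mem_chart_source (EuclideanSpace ℝ (Fin m)) x
  refine (g.isRadical_iff_frame hxs _).2 fun b ↦ ?_
  obtain ⟨V, hV, hxV, hs⟩ := (smoothNear_frame hxs b).exists_smoothOn
  have h1 := hw V hV hxV _ hs
  have h2 := hF _ (smoothNear_frame hxs b).diffAt
  rw [map_sub, sub_apply, h2, sub_eq_zero]
  exact h1

theorem IsTransverseRiemannLorentz.field_eq_of_eq_off_sing (hg : g.IsTransverseRiemannLorentz)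
    (hF : SmoothNear F p) (hG : SmoothNear G p) (h : ∀ᶠ x in 𝓝 p, x ∉ g.sing → F x = G x) :
    F p = G p := by
  have hps := mem_chart_source (EuclideanSpace ℝ (Fin m)) p
  rw [← sum_frameCoeff_smul_frame hps (F p), ← sum_frameCoeff_smul_frame hps (G p)]
  refine Finset.sum_congr rfl fun a _ ↦ ?_
  congr 1
  refine hg.eq_of_eq_off_sing (f := fun y ↦ frameCoeff p a y (F y))
    (h := fun y ↦ frameCoeff p a y (G y)) (hF.frameCoeff hps a).diffFunAt.continuousAt
    (hG.frameCoeff hps a).diffFunAt.continuousAt ?_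
  filter_upwards [h] with x hx hxs
  rw [hx hxs]

theorem IsTransverseRiemannLorentz.goodLimit_eq (hg : g.IsTransverseRiemannLorentz)
    (hF : SmoothNear F p) (h : ∀ᶠ x in 𝓝 p, x ∉ g.sing → F x = G x) : g.goodLimit G p = F p := by
  obtain ⟨V, hV, hpV, hFV⟩ := hF.exists_smoothOn
  obtain ⟨W, hW, hWo, hpW⟩ := eventually_nhds_iff.1 h
  obtain ⟨V', hV', hpV', F', hF', hFG, hlim⟩ := Classical.epsilon_spec
    (p := fun w : TangentSpace (𝓡 m) p ↦ ∃ V : Set M, IsOpen V ∧ p ∈ V ∧ ∃ F' : VField m M,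
      SmoothOn F' V ∧ (∀ x ∈ V \ g.sing, F' x = G x) ∧ F' p = w)
    ⟨F p, V ∩ W, hV.inter hWo, ⟨hpV, hpW⟩, F, hFV.mono inter_subset_left,
      fun x hx ↦ hW x hx.1.2 hx.2, rfl⟩
  refine hlim.symm.trans ?_
  refine hg.field_eq_of_eq_off_sing (hF'.smoothNear hV' hpV') hF ?_
  filter_upwards [hV'.mem_nhds hpV', h] with x h1 h2 h3
  rw [h2 h3, hFG x ⟨h1, h3⟩]

theorem IsTransverseRiemannLorentz.goodLimit_nabla_eq (hg : g.IsTransverseRiemannLorentz)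
    (hF : SmoothNear F p) (h : ∀ᶠ x in 𝓝 p, g.Represents F A B x) :
    g.goodLimit (g.nabla A B) p = F p := by
  refine hg.goodLimit_eq hF ?_
  filter_upwards [h] with x h1 h2 using (nabla_eq h1 h2).symm

end SymTensor

end RiemannLorentz

/-! ### Fields along a subset: independence of the extensions. -/

namespace RiemannLorentz

section Bracket

variable {m : ℕ} {M : Type*} [TopologicalSpace M] [ChartedSpace (EuclideanSpace ℝ (Fin m)) M]
  [IsManifold (𝓡 m) ∞ M] {A B : VField m M} {p x : M}

theorem lie_sum_right {ι : Type*} {s : Finset ι} {B : ι → VField m M}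
    (hB : ∀ i ∈ s, SmoothNear (B i) x) :
    mlieBracket (𝓡 m) A (fun y ↦ ∑ i ∈ s, B i y) x = ∑ i ∈ s, mlieBracket (𝓡 m) A (B i) x := by
  classical
  induction s using Finset.induction_on with
  | empty =>
    simp only [Finset.sum_empty]
    exact congrFun (mlieBracket_zero_right (I := 𝓡 m) (W := A)) x
  | insert a s ha ih =>
    simp only [Finset.mem_insert, forall_eq_or_imp] at hB
    simp only [Finset.sum_insert ha, ← ih hB.2]
    exact mlieBracket_add_right hB.1.diffAt (SmoothNear.sum hB.2).diffAt

end Bracket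

section Along

variable {m : ℕ} {M : Type*} [TopologicalSpace M] [ChartedSpace (EuclideanSpace ℝ (Fin m)) M]
  [IsManifold (𝓡 m) ∞ M] {S V : Set M} {A A' A'' B B' B'' C C' X X' Y Y' : VField m M} {p : M}

/-- `A'` is smooth near `p` and extends, near `p`, the field `A` along `S`. -/
def Extends (S : Set M) (A A' : VField m M) (p : M) : Prop :=
  SmoothNear A' p ∧ ∀ᶠ q in 𝓝 p, q ∈ S → A' q = A q

theorem Extends.eventually (h : Extends S A A' p) : ∀ᶠ q in 𝓝 p, Extends S A A' q := by
  filter_upwards [h.1.eventually, h.2.eventually_nhds] with q h1 h2 using ⟨h1, h2⟩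

theorem Extends.diffAt (h : Extends S A A' p) : DiffAt A' p := h.1.diffAt

theorem Extends.eq (h : Extends S A A' p) (hp : p ∈ S) : A' p = A p := h.2.self_of_nhds hp

theorem IsExtension.extends (h : IsExtension S V A A') (hV : IsOpen V) (hp : p ∈ V) :
    Extends S A A' p := by
  refine ⟨h.1.smoothNear hV hp, ?_⟩
  filter_upwards [hV.mem_nhds hp] with q h1 h2 using h.2 q ⟨h2, h1⟩

theorem Extends.exists_isExtension (h : Extends S A A' p) :
    ∃ V, IsOpen V ∧ p ∈ V ∧ IsExtension S V A A' := by
  obtain ⟨V, hV, hpV, hs⟩ := h.1.exists_smoothOn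
  obtain ⟨W, hW, hWo, hpW⟩ := eventually_nhds_iff.1 h.2
  exact ⟨V ∩ W, hV.inter hWo, ⟨hpV, hpW⟩, hs.mono inter_subset_left, fun q hq ↦ hW q hq.2.2 hq.1⟩

theorem IsExtension.mono {W : Set M} (h : IsExtension S V A A') (hW : W ⊆ V) :
    IsExtension S W A A' :=
  ⟨h.1.mono hW, fun q hq ↦ h.2 q ⟨hq.1, hW hq.2⟩⟩

theorem IsFieldAlong.exists_extends (h : IsFieldAlong S A) (hp : p ∈ S) :
    ∃ A', Extends S A A' p := by
  obtain ⟨V, hV, hpV, A', hA'⟩ := h p hp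
  exact ⟨A', hA'.extends hV hpV⟩

theorem isFieldAlong_of_exists_extends (h : ∀ p ∈ S, ∃ A', Extends S A A' p) :
    IsFieldAlong S A := by
  intro p hp
  obtain ⟨A', hA'⟩ := h p hp
  obtain ⟨V, hV, hpV, hext⟩ := hA'.exists_isExtension
  exact ⟨V, hV, hpV, A', hext⟩

omit [IsManifold (𝓡 m) ∞ M] in
theorem IsTangentAt.dirDeriv_eq_zero {v : TangentSpace (𝓡 m) p} (hv : IsTangentAt S p v) {f : M → ℝ}
    (hf : SmoothFunNear m f p) (h0 : ∀ᶠ q in 𝓝 p, q ∈ S → f q = 0) : dirDeriv f p v = 0 := by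
  obtain ⟨V, hV, hpV, hs⟩ := hf.exists_smoothFunOn
  obtain ⟨W, hW, hWo, hpW⟩ := eventually_nhds_iff.1 h0
  exact hv (V ∩ W) (hV.inter hWo) ⟨hpV, hpW⟩ f (hs.mono inter_subset_left)
    fun q hq ↦ hW q hq.2.2 hq.1

omit [IsManifold (𝓡 m) ∞ M] in
theorem IsTangentAt.add {v w : TangentSpace (𝓡 m) p} (hv : IsTangentAt S p v)
    (hw : IsTangentAt S p w) : IsTangentAt S p (v + w) := fun V hV hp f hf h0 ↦ by
  rw [dirDeriv_vadd, hv V hV hp f hf h0, hw V hV hp f hf h0, add_zero]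

omit [IsManifold (𝓡 m) ∞ M] in
theorem IsTangentAt.smul {v : TangentSpace (𝓡 m) p} (hv : IsTangentAt S p v) (c : ℝ) :
    IsTangentAt S p (c • v) := fun V hV hp f hf h0 ↦ by
  rw [dirDeriv_vsmul, hv V hV hp f hf h0, mul_zero]

/-- The components of `B` vanish on `S`, so their derivatives along the tangent vector `A p` vanish
as well, and these are the only surviving terms of the Leibniz rule. -/
theorem mlieBracket_eq_zero_of_vanishing (hB : SmoothNear B p) (hp : p ∈ S)
    (hAt : IsTangentAt S p (A p)) (hB0 : ∀ᶠ q in 𝓝 p, q ∈ S → B q = 0) :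
    mlieBracket (𝓡 m) A B p = 0 := by
  have hps := mem_chart_source (EuclideanSpace ℝ (Fin m)) p
  have hc : ∀ a, SmoothFunNear m (fun y ↦ frameCoeff p a y (B y)) p := fun a ↦ hB.frameCoeff hps a
  have h1 : B =ᶠ[𝓝 p] fun y ↦ ∑ a, ((fun y ↦ frameCoeff p a y (B y)) • frame p a) y := by
    filter_upwards [(chartAt (EuclideanSpace ℝ (Fin m)) p).open_source.mem_nhds hps] with y hy
    exact (sum_frameCoeff_smul_frame hy (B y)).symm
  rw [lie_congr_right h1]
  refine (lie_sum_right (B := fun a ↦ (fun y ↦ frameCoeff p a y (B y)) • frame p a)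
    fun a _ ↦ (smoothNear_frame hps a).smul (hc a)).trans ?_
  refine Finset.sum_eq_zero fun a _ ↦ ?_
  rw [lie_smul_right (hc a).diffFunAt (smoothNear_frame hps a).diffAt,
    hAt.dirDeriv_eq_zero (hc a) (hB0.mono fun q hq hqS ↦ by rw [hq hqS, map_zero]),
    hB0.self_of_nhds hp, map_zero, zero_smul, zero_smul, add_zero]

theorem mlieBracket_eq_of_extends_right (hB : Extends S B B' p)
    (hB' : Extends S B B'' p) (hp : p ∈ S) (hAt : IsTangentAt S p (A p)) :
    mlieBracket (𝓡 m) A B' p = mlieBracket (𝓡 m) A B'' p := by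
  have h1 : B' = B'' + (B' - B'') := by abel
  have h2 : SmoothNear (B' - B'') p := hB.1.sub hB'.1
  rw [h1, mlieBracket_add_right hB'.diffAt h2.diffAt,
    mlieBracket_eq_zero_of_vanishing h2 hp hAt, add_zero]
  filter_upwards [hB.2, hB'.2] with q h3 h4 h5
  rw [Pi.sub_apply, h3 h5, h4 h5, sub_self]

theorem bracketOn_eq (hX : Extends S X X' p) (hY : Extends S Y Y' p) (hp : p ∈ S)
    (hXt : IsTangentAt S p (X p)) (hYt : IsTangentAt S p (Y p)) :
    bracketOn S X Y p = mlieBracket (𝓡 m) X' Y' p := by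
  obtain ⟨V, hV, hpV, hXV⟩ := hX.exists_isExtension
  obtain ⟨W, hW, hpW, hYW⟩ := hY.exists_isExtension
  obtain ⟨V', hV', hpV', X'', Y'', hX'', hY'', hlie⟩ := Classical.epsilon_spec
    (p := fun w : TangentSpace (𝓡 m) p ↦ ∃ V : Set M, IsOpen V ∧ p ∈ V ∧ ∃ X' Y' : VField m M,
      IsExtension S V X X' ∧ IsExtension S V Y Y' ∧ mlieBracket (𝓡 m) X' Y' p = w)
    ⟨_, V ∩ W, hV.inter hW, ⟨hpV, hpW⟩, X', Y', hXV.mono inter_subset_left,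
      hYW.mono inter_subset_right, rfl⟩
  refine hlie.symm.trans ?_
  have eX := hX''.extends hV' hpV'
  have eY := hY''.extends hV' hpV'
  rw [mlieBracket_eq_of_extends_right eY hY hp (by rwa [eX.eq hp]),
    mlieBracket_swap_apply, mlieBracket_eq_of_extends_right eX hX hp (by rwa [hY.eq hp]),
    ← mlieBracket_swap_apply]

/-- As a commutator of derivations, the bracket kills functions vanishing on `S`: derivatives of
such functions along tangent fields again vanish on `S`. -/
theorem isTangentAt_mlieBracket (hX : IsFieldOn S X) (hY : IsFieldOn S Y) (eX : Extends S X X' p)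
    (eY : Extends S Y Y' p) (hp : p ∈ S) : IsTangentAt S p (mlieBracket (𝓡 m) X' Y' p) := by
  intro V hV hpV f hf h0
  have hfp := hf.smoothFunNear hV hpV
  have key : ∀ {X X' : VField m M}, IsFieldOn S X → Extends S X X' p →
      ∀ᶠ q in 𝓝 p, q ∈ S → dirDeriv f q (X' q) = 0 := fun {X X'} hX eX ↦ by
    filter_upwards [eX.eventually, hV.mem_nhds hpV] with q h1 h2 h3
    rw [h1.eq h3]
    exact hX.2 q h3 V hV h2 f hf h0
  rw [dirDeriv_mlieBracket eX.1 eY.1 hfp, eX.eq hp, eY.eq hp,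
    (hX.2 p hp).dirDeriv_eq_zero (SmoothFunNear.dirDeriv hfp eY.1) (key hY eY),
    (hY.2 p hp).dirDeriv_eq_zero (SmoothFunNear.dirDeriv hfp eX.1) (key hX eX), sub_zero]

theorem extends_bracketOn (hX : IsFieldOn S X) (hY : IsFieldOn S Y) (eX : Extends S X X' p)
    (eY : Extends S Y Y' p) : Extends S (bracketOn S X Y) (mlieBracket (𝓡 m) X' Y') p := by
  refine ⟨eX.1.mlieBracket eY.1, ?_⟩
  filter_upwards [eX.eventually, eY.eventually] with q h1 h2 h3
  exact (bracketOn_eq h1 h2 h3 (hX.2 q h3) (hY.2 q h3)).symm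

theorem IsFieldOn.bracketOn (hX : IsFieldOn S X) (hY : IsFieldOn S Y) :
    IsFieldOn S (bracketOn S X Y) := by
  refine ⟨isFieldAlong_of_exists_extends fun p hp ↦ ?_, fun p hp ↦ ?_⟩ <;>
    obtain ⟨X', eX⟩ := hX.1.exists_extends hp <;> obtain ⟨Y', eY⟩ := hY.1.exists_extends hp
  · exact ⟨_, extends_bracketOn hX hY eX eY⟩
  · rw [← (extends_bracketOn hX hY eX eY).eq hp]
    exact isTangentAt_mlieBracket hX hY eX eY hp

namespace SymTensor

variable {g : SymTensor m M}

theorem dual_eq_zero_of_left (hA : DiffAt A p) (hB : DiffAt B p) (hC : DiffAt C p) (h0 : A p = 0) :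
    g.dual A B C p = 0 := by
  have hT := g.tensorialAt_dual_left hB hC
  rw [← hT.zero]
  exact hT.pointwise hA (mdifferentiable_zeroSection ℝ _ _) h0

theorem dual_eq_zero_of_right (hA : DiffAt A p) (hB : DiffAt B p) (hC : DiffAt C p)
    (h0 : C p = 0) : g.dual A B C p = 0 := by
  have hT := g.tensorialAt_dual_right hA hB
  rw [← hT.zero]
  exact hT.pointwise hC (mdifferentiable_zeroSection ℝ _ _) h0

/-- The middle slot is not tensorial, but metric compatibility writes the value as `A⟨B,C⟩ - □_A
C(B)`, and both terms vanish when `A` is tangent and `B` is zero along `S`. -/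
theorem dual_eq_zero_of_mid (hA : SmoothNear A p) (hB : SmoothNear B p) (hC : SmoothNear C p)
    (hp : p ∈ S) (hAt : IsTangentAt S p (A p)) (hB0 : ∀ᶠ q in 𝓝 p, q ∈ S → B q = 0) :
    g.dual A B C p = 0 := by
  have h1 := g.dual_add_dual_swap A B C p
  rwa [dual_eq_zero_of_right hA.diffAt hC.diffAt hB.diffAt (hB0.self_of_nhds hp),
    hAt.dirDeriv_eq_zero (g.smoothFunNear_form hB hC) (hB0.mono fun q hq hqS ↦ by
      rw [hq hqS, map_zero, zero_apply]), add_zero] at h1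

theorem dual_eq_of_extends (eA : Extends S A A' p) (eA' : Extends S A A'' p)
    (eB : Extends S B B' p) (eB' : Extends S B B'' p) (hC : SmoothNear C p)
    (hC' : SmoothNear C' p) (hCC' : C p = C' p) (hp : p ∈ S) (hAt : IsTangentAt S p (A p)) :
    g.dual A' B' C p = g.dual A'' B'' C' p := by
  have h1 : B' = B'' + (B' - B'') := by abel
  have h2 : SmoothNear (B' - B'') p := eB.1.sub eB'.1
  rw [g.dual_congr_right eA.diffAt eB.diffAt hC.diffAt hC'.diffAt hCC',
    g.dual_congr_left eA.diffAt eA'.diffAt eB.diffAt hC'.diffAt ((eA.eq hp).trans (eA'.eq hp).symm),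
    h1, g.dual_add_mid eA'.diffAt eB'.diffAt h2.diffAt hC'.diffAt,
    dual_eq_zero_of_mid eA'.1 h2 hC' hp (by rwa [eA'.eq hp]), add_zero]
  filter_upwards [eB.2, eB'.2] with q h3 h4 h5
  rw [Pi.sub_apply, h3 h5, h4 h5, sub_self]

theorem dualAlong_eq (eA : Extends S A A' p) (eB : Extends S B B' p) (eC : Extends S C C' p)
    (hp : p ∈ S) (hAt : IsTangentAt S p (A p)) :
    g.dualAlong S A B C p = g.dual A' B' C' p := by
  obtain ⟨V, hV, hpV, hAV⟩ := eA.exists_isExtension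
  obtain ⟨W, hW, hpW, hBW⟩ := eB.exists_isExtension
  obtain ⟨O, hO, hpO, hCO⟩ := eC.exists_isExtension
  obtain ⟨V', hV', hpV', A'', B'', C'', hA'', hB'', hC'', hdual⟩ := Classical.epsilon_spec
    (p := fun r : ℝ ↦ ∃ V : Set M, IsOpen V ∧ p ∈ V ∧ ∃ A' B' C' : VField m M,
      IsExtension S V A A' ∧ IsExtension S V B B' ∧ IsExtension S V C C' ∧ g.dual A' B' C' p = r)
    ⟨_, V ∩ (W ∩ O), hV.inter (hW.inter hO), ⟨hpV, hpW, hpO⟩, A', B', C',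
      hAV.mono inter_subset_left, hBW.mono (inter_subset_right.trans inter_subset_left),
      hCO.mono (inter_subset_right.trans inter_subset_right), rfl⟩
  refine hdual.symm.trans ?_
  have fC := hC''.extends hV' hpV'
  exact dual_eq_of_extends (hA''.extends hV' hpV') eA (hB''.extends hV' hpV') eB fC.1 eC.1
    ((fC.eq hp).trans (eC.eq hp).symm) hp hAt

theorem dual_swap_of_isRadical (A B : VField m M) (hC : g.IsRadical p (C p)) :
    g.dual A B C p = g.dual B A C p := by
  have h1 := g.dual_sub_dual_swap A B C p
  rw [g.symm, hC] at h1
  exact sub_eq_zero.1 h1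

theorem dual_self_of_isRadical (hA : IsTangentAt S p (A p)) (hB : SmoothNear B p)
    (hrad : ∀ᶠ q in 𝓝 p, q ∈ S → g.IsRadical q (B q)) : g.dual A B B p = 0 := by
  have h1 := g.dual_add_dual_swap A B B p
  rw [hA.dirDeriv_eq_zero (g.smoothFunNear_form hB hB) (hrad.mono fun q hq hqS ↦ hq hqS _)] at h1
  linarith

end SymTensor

end Along

end RiemannLorentz

/-! ### Tangency to `Σ`, the screen distribution and `II`-flatness. -/

namespace RiemannLorentz

namespace SymTensor

variable {m : ℕ} {M : Type*} [TopologicalSpace M] [ChartedSpace (EuclideanSpace ℝ (Fin m)) M]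
  [IsManifold (𝓡 m) ∞ M] {g : SymTensor m M} {U : Set M} {N R : VField m M}
  {D : VField m M → VField m M → VField m M} {X Y Z T X' Y' Z' T' N' C : VField m M} {p : M}

theorem HasTangentRadical.isTangentAt (hrad : g.HasTangentRadical) (hU : IsOpen U)
    (hp : p ∈ g.sing ∩ U) {v : TangentSpace (𝓡 m) p} (hv : g.IsRadical p v) :
    IsTangentAt (g.sing ∩ U) p v := fun V hV hpV f hf h0 ↦
  hrad p hp.1 v hv (V ∩ U) (hV.inter hU) ⟨hpV, hp.2⟩ f (hf.mono inter_subset_left)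
    fun q hq ↦ h0 q ⟨⟨hq.1, hq.2.2⟩, hq.2.1⟩

theorem secondForm_eq {S : Set M} (hp : p ∈ S)
    (eX : Extends S X X' p) (eY : Extends S Y Y' p) (eN : Extends S N N' p)
    (hXt : IsTangentAt S p (X p)) : g.secondForm S N X Y p = g.dual X' Y' N' p :=
  dualAlong_eq eX eY eN hp hXt

/-- Every function vanishing on `Σ` is locally a multiple of `det G`, so killing `det G` to first
order suffices. -/
theorem IsTransverseRiemannLorentz.isTangentAt_of_dirDeriv (hg : g.IsTransverseRiemannLorentz)
    (hU : IsOpen U) (hp : p ∈ g.sing ∩ U) {v : TangentSpace (𝓡 m) p}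
    (hv : dirDeriv (fun y ↦ (g.gram p y).det) p v = 0) : IsTangentAt (g.sing ∩ U) p v := by
  intro V hV hpV f hf h0
  have hps := mem_chart_source (EuclideanSpace ℝ (Fin m)) p
  have hτ := g.smoothFunNear_det_gram hps
  obtain ⟨h, hh, hfh⟩ := exists_mul_of_eq_zero (hf.smoothFunNear hV hpV) hτ
    (fun _ ↦ hg.mfderiv_det_gram_ne_zero hps hp.1) (by
      filter_upwards [hV.mem_nhds hpV, hU.mem_nhds hp.2,
        (chartAt (EuclideanSpace ℝ (Fin m)) p).open_source.mem_nhds hps] with x h1 h2 h3 h4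
      exact h0 x ⟨⟨(g.mem_sing_iff h3).2 h4, h2⟩, h1⟩)
  rw [dirDeriv_congr hfh, dirDeriv_mul hτ.diffFunAt hh.diffFunAt, hv,
    (g.mem_sing_iff hps).1 hp.1, zero_mul, zero_mul, add_zero]

/-- The vectors orthogonal to the main normal are tangent to `Σ`. -/
theorem IsMainPair.isTangentAt_of_form_eq_zero (hg : g.IsTransverseRiemannLorentz) (hU : IsOpen U)
    (hNR : g.IsMainPair (g.sing ∩ U) N R) (hp : p ∈ g.sing ∩ U) {v : TangentSpace (𝓡 m) p}
    (hv : g.form p (N p) v = 0) : IsTangentAt (g.sing ∩ U) p v := by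
  set dτ : TangentSpace (𝓡 m) p → ℝ := dirDeriv (fun y ↦ (g.gram p y).det) p with hdτ
  have hN : dτ (N p) ≠ 0 := fun h ↦ by
    have h1 := hNR.orthogonal p hp _ (hg.isTangentAt_of_dirDeriv hU hp h)
    rw [hNR.unitary p hp] at h1
    exact one_ne_zero h1
  -- Subtracting a multiple of `N` makes `v` tangent; pairing the result with `N` shows that this
  -- multiple was zero.
  have h1 : dτ (v + (-(dτ v / dτ (N p))) • N p) = 0 := by
    rw [hdτ, dirDeriv_vadd, dirDeriv_vsmul, ← hdτ]
    field_simp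
    ring
  have h2 := hNR.orthogonal p hp _ (hg.isTangentAt_of_dirDeriv hU hp h1)
  rw [map_add, map_smul, hv, hNR.unitary p hp, zero_add, smul_eq_mul, mul_one, neg_eq_zero,
    div_eq_zero_iff, or_iff_left hN] at h2
  exact hg.isTangentAt_of_dirDeriv hU hp h2

theorem IsMainPair.radical_isFieldOn (hrad : g.HasTangentRadical) (hU : IsOpen U)
    (hNR : g.IsMainPair (g.sing ∩ U) N R) : IsFieldOn (g.sing ∩ U) R :=
  ⟨hNR.radical_smooth, fun p hp ↦ hrad.isTangentAt hU hp (hNR.radical p hp)⟩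

/-- The component of a tangent field in the screen distribution. -/
theorem IsMainPair.isScreenField (hrad : g.HasTangentRadical) (hU : IsOpen U)
    (hNR : g.IsMainPair (g.sing ∩ U) N R) (hX : IsFieldOn (g.sing ∩ U) X) :
    g.IsScreenField (g.sing ∩ U) N R (X + g.secondForm (g.sing ∩ U) N X R • R) ∧
    ∀ {p : M} {X' R' N' : VField m M}, Extends (g.sing ∩ U) X X' p →
      Extends (g.sing ∩ U) R R' p → Extends (g.sing ∩ U) N N' p →
      Extends (g.sing ∩ U) (X + g.secondForm (g.sing ∩ U) N X R • R)
        (X' + g.dual X' R' N' • R') p := by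
  have hR := hNR.radical_isFieldOn hrad hU
  have ext : ∀ {p : M} {X' R' N' : VField m M}, Extends (g.sing ∩ U) X X' p →
      Extends (g.sing ∩ U) R R' p → Extends (g.sing ∩ U) N N' p →
      Extends (g.sing ∩ U) (X + g.secondForm (g.sing ∩ U) N X R • R)
        (X' + g.dual X' R' N' • R') p := fun {p X' R' N'} eX eR eN ↦ by
    refine ⟨eX.1.add (eR.1.smul (g.smoothFunNear_dual eX.1 eR.1 eN.1)), ?_⟩
    filter_upwards [eX.eventually, eR.eventually, eN.eventually] with q h1 h2 h3 hq
    rw [Pi.add_apply, Pi.add_apply, Pi.smul_apply', Pi.smul_apply',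
      secondForm_eq hq h1 h2 h3 (hX.2 q hq), h1.eq hq, h2.eq hq]
  refine ⟨⟨⟨isFieldAlong_of_exists_extends fun p hp ↦ ?_, fun p hp ↦
    (hX.2 p hp).add ((hR.2 p hp).smul _)⟩, fun p hp ↦ ?_⟩, ext⟩ <;>
    obtain ⟨X', eX⟩ := hX.1.exists_extends hp <;> obtain ⟨R', eR⟩ := hR.1.exists_extends hp <;>
    obtain ⟨N', eN⟩ := hNR.normal_smooth.exists_extends hp
  · exact ⟨_, ext eX eR eN⟩
  · have ha := g.smoothFunNear_dual eX.1 eR.1 eN.1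
    have hT := g.tensorialAt_dual_left eR.diffAt eN.diffAt
    have h1 := hNR.normalized p hp
    rw [secondForm_eq hp eR eR eN (hR.2 p hp)] at h1
    rw [secondForm_eq hp (ext eX eR eN) eR eN ((hX.2 p hp).add ((hR.2 p hp).smul _)),
      hT.add eX.diffAt (eR.1.smul ha).diffAt, hT.smul ha.diffFunAt eR.diffAt, h1]
    simp

/-- If `Σ` is `II`-flat, `□_X Y` vanishes on the radical for all `X`, `Y` tangent to `Σ`. -/
theorem IsIIFlat.dual_eq_zero (hg : g.IsTransverseRiemannLorentz) (hrad : g.HasTangentRadical)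
    (hU : IsOpen U) (hNR : g.IsMainPair (g.sing ∩ U) N R) (hflat : g.IsIIFlat U N R)
    (hX : IsFieldOn (g.sing ∩ U) X) (hY : IsFieldOn (g.sing ∩ U) Y) (hp : p ∈ g.sing ∩ U)
    (eX : Extends (g.sing ∩ U) X X' p) (eY : Extends (g.sing ∩ U) Y Y' p) (hC : DiffAt C p)
    (hCr : g.IsRadical p (C p)) : g.dual X' Y' C p = 0 := by
  have hR := hNR.radical_isFieldOn hrad hU
  obtain ⟨R', eR⟩ := hR.1.exists_extends hp
  obtain ⟨N', eN⟩ := hNR.normal_smooth.exists_extends hp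
  have hR' : g.IsRadical p (R' p) := by
    rw [eR.eq hp]
    exact hNR.radical p hp
  have hR0 : R' p ≠ 0 := fun h0 ↦ by
    have h1 := hNR.normalized p hp
    rw [secondForm_eq hp eR eR eN (hR.2 p hp),
      dual_eq_zero_of_left eR.diffAt eR.diffAt eN.diffAt h0] at h1
    norm_num at h1
  have hRad : ∀ᶠ q in 𝓝 p, q ∈ g.sing ∩ U → g.IsRadical q (R' q) := by
    filter_upwards [eR.2] with q h1 h2
    rw [h1 h2]
    exact hNR.radical q h2
  obtain ⟨hV, extV⟩ := hNR.isScreenField hrad hU hX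
  obtain ⟨hW, extW⟩ := hNR.isScreenField hrad hU hY
  have eV := extV eX eR eN
  have eW := extW eY eR eN
  have h0 := hflat U hU subset_rfl _ _ hV hW p hp
  have ha := g.smoothFunNear_dual eX.1 eR.1 eN.1
  have hb := g.smoothFunNear_dual eY.1 eR.1 eN.1
  rw [II, dualAlong_eq eV eW eR hp (hV.1.2 p hp)] at h0
  have hT := g.tensorialAt_dual_left eW.diffAt eR.diffAt
  -- Expands `II(X + aR, Y + bR)`. The terms with `R` vanish: `II` is symmetric, `□_A R(R) = 0` for
  -- tangent `A`, and the derivative of the coefficient `b` multiplies `⟨R,R⟩ = 0`.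
  rw [hT.add eX.diffAt (eR.1.smul ha).diffAt, hT.smul ha.diffFunAt eR.diffAt,
    dual_swap_of_isRadical R' _ hR', dual_self_of_isRadical (by
      rw [eW.eq hp]
      exact hW.1.2 p hp) eR.1 hRad, smul_zero, add_zero,
    g.dual_add_mid eX.diffAt eY.diffAt (eR.1.smul hb).diffAt eR.diffAt,
    g.dual_smul_mid eX.diffAt hb.diffFunAt eR.diffAt eR.diffAt, hR', mul_zero, add_zero,
    dual_self_of_isRadical (by
      rw [eX.eq hp]
      exact hX.2 p hp) eR.1 hRad, mul_zero, add_zero] at h0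
  obtain ⟨c, hc⟩ := hg.exists_smul_of_isRadical hp.1 hCr hR' hR0
  have hT' := g.tensorialAt_dual_right eX.diffAt eY.diffAt
  rw [g.dual_congr_right eX.diffAt eY.diffAt hC (C' := (fun _ ↦ c) • R')
    (eR.1.smul (smoothFunNear_const c)).diffAt hc,
    hT'.smul (smoothFunNear_const c).diffFunAt eR.diffAt, h0, smul_zero]

theorem IsIIFlat.exists_represents (hg : g.IsTransverseRiemannLorentz)
    (hrad : g.HasTangentRadical) (hU : IsOpen U) (hNR : g.IsMainPair (g.sing ∩ U) N R)
    (hflat : g.IsIIFlat U N R) (hX : IsFieldOn (g.sing ∩ U) X) (hY : IsFieldOn (g.sing ∩ U) Y)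
    (hp : p ∈ U) (eX : Extends (g.sing ∩ U) X X' p) (eY : Extends (g.sing ∩ U) Y Y' p) :
    ∃ F : VField m M, SmoothNear F p ∧ ∀ᶠ x in 𝓝 p, g.Represents F X' Y' x := by
  refine hg.exists_represents eX.1 eY.1 ?_
  filter_upwards [hU.mem_nhds hp, eX.eventually, eY.eventually] with x hx h1 h2 h3 C hC hCr
  exact hflat.dual_eq_zero hg hrad hU hNR hX hY ⟨h3, hx⟩ h1 h2 hC hCr

end SymTensor

end RiemannLorentz

/-! ### The tangential connection and the Gauss formula. -/

namespace RiemannLorentz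

namespace SymTensor

variable {m : ℕ} {M : Type*} [TopologicalSpace M] [ChartedSpace (EuclideanSpace ℝ (Fin m)) M]
  [IsManifold (𝓡 m) ∞ M] {g : SymTensor m M} {U : Set M} {N R N' : VField m M}
  {D : VField m M → VField m M → VField m M} {X Y Z T X' Y' Z' T' A B C F F' : VField m M} {p : M}

/-- Near each point of `Σ`, the tangential connection is the tangential part of a smooth field
representing the dual derivative. -/
theorem IsTangentialConnection.exists_represents (hg : g.IsTransverseRiemannLorentz)
    (hrad : g.HasTangentRadical) (hU : IsOpen U) (hNR : g.IsMainPair (g.sing ∩ U) N R)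
    (hflat : g.IsIIFlat U N R) (hD : g.IsTangentialConnection U N N' D)
    (hX : IsFieldOn (g.sing ∩ U) X) (hY : IsFieldOn (g.sing ∩ U) Y) (hp : p ∈ g.sing ∩ U) :
    ∃ X' Y' F : VField m M, Extends (g.sing ∩ U) X X' p ∧ Extends (g.sing ∩ U) Y Y' p ∧
      SmoothNear F p ∧ (∀ᶠ x in 𝓝 p, g.Represents F X' Y' x) ∧
      ∀ᶠ q in 𝓝 p, q ∈ g.sing → D X Y q = F q - g.form q (F q) (N q) • N q := by
  obtain ⟨V, hV, hpV, -, X', Y', hX', hY', hDXY⟩ := hD X Y hX hY p hp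
  have eX := hX'.1.extends hV hpV
  have eY := hY'.1.extends hV hpV
  obtain ⟨F, hF, hrep⟩ := hflat.exists_represents hg hrad hU hNR hX hY hp.2 eX eY
  refine ⟨X', Y', F, eX, eY, hF, hrep, ?_⟩
  filter_upwards [hV.mem_nhds hpV, hF.eventually, hrep.eventually_nhds] with q h1 h2 h3 hq
  rw [hDXY q ⟨hq, h1⟩, hg.goodLimit_nabla_eq h2 h3]

/-- Since `□_X Y` along `Σ` does not depend on the extensions of tangent fields, the canonical
extensions defining `D` may be replaced by arbitrary ones. -/
theorem IsTangentialConnection.form_eq (hg : g.IsTransverseRiemannLorentz)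
    (hrad : g.HasTangentRadical) (hU : IsOpen U) (hNR : g.IsMainPair (g.sing ∩ U) N R)
    (hflat : g.IsIIFlat U N R) (hD : g.IsTangentialConnection U N N' D)
    (hX : IsFieldOn (g.sing ∩ U) X) (hY : IsFieldOn (g.sing ∩ U) Y) (hp : p ∈ g.sing ∩ U)
    (eX : Extends (g.sing ∩ U) X X' p) (eY : Extends (g.sing ∩ U) Y Y' p) (hC : SmoothNear C p) :
    g.form p (D X Y p) (C p) =
      g.dual X' Y' C p - g.secondForm (g.sing ∩ U) N X Y p * g.form p (N p) (C p) := by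
  obtain ⟨X'', Y'', F, eX'', eY'', hF, hrep, hDXY⟩ :=
    hD.exists_represents hg hrad hU hNR hflat hX hY hp
  obtain ⟨N'', eN⟩ := hNR.normal_smooth.exists_extends hp
  have h1 := hrep.self_of_nhds C hC.diffAt
  have h2 := hrep.self_of_nhds N'' eN.diffAt
  rw [dual_eq_of_extends eX'' eX eY'' eY hC hC rfl hp (hX.2 p hp)] at h1
  rw [← secondForm_eq hp eX'' eY'' eN (hX.2 p hp), eN.eq hp] at h2
  rw [hDXY.self_of_nhds hp.1, map_sub, map_smul, sub_apply, smul_apply, h1, h2, smul_eq_mul]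

/-- Tangency holds because removing the `N`-component leaves a vector orthogonal to `N`. It is what
allows `D` to be iterated. -/
theorem IsTangentialConnection.isFieldOn (hg : g.IsTransverseRiemannLorentz)
    (hrad : g.HasTangentRadical) (hU : IsOpen U) (hNR : g.IsMainPair (g.sing ∩ U) N R)
    (hflat : g.IsIIFlat U N R) (hD : g.IsTangentialConnection U N N' D)
    (hX : IsFieldOn (g.sing ∩ U) X) (hY : IsFieldOn (g.sing ∩ U) Y) :
    IsFieldOn (g.sing ∩ U) (D X Y) := by
  refine ⟨isFieldAlong_of_exists_extends fun p hp ↦ ?_, fun p hp ↦ ?_⟩ <;>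
    obtain ⟨X', Y', F, eX, eY, hF, hrep, hDXY⟩ :=
      hD.exists_represents hg hrad hU hNR hflat hX hY hp
  · obtain ⟨N'', eN⟩ := hNR.normal_smooth.exists_extends hp
    refine ⟨F - (fun y ↦ g.form y (F y) (N'' y)) • N'',
      hF.sub (eN.1.smul (g.smoothFunNear_form hF eN.1)), ?_⟩
    filter_upwards [hDXY, eN.2] with q h1 h2 hq
    rw [h1 hq.1, Pi.sub_apply, Pi.smul_apply', h2 hq]
  · refine hNR.isTangentAt_of_form_eq_zero hg hU hp ?_
    rw [hDXY.self_of_nhds hp.1, map_sub, map_smul, hNR.unitary p hp, g.symm p (N p), smul_eq_mul,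
      mul_one, sub_self]

theorem IsTangentialConnection.form_second_derivative (hg : g.IsTransverseRiemannLorentz)
    (hrad : g.HasTangentRadical) (hU : IsOpen U) (hNR : g.IsMainPair (g.sing ∩ U) N R)
    (hflat : g.IsIIFlat U N R) (hD : g.IsTangentialConnection U N N' D)
    (hX : IsFieldOn (g.sing ∩ U) X) (hY : IsFieldOn (g.sing ∩ U) Y)
    (hZ : IsFieldOn (g.sing ∩ U) Z) (hT : IsFieldOn (g.sing ∩ U) T) (hp : p ∈ g.sing ∩ U)
    (eX : Extends (g.sing ∩ U) X X' p) (eY : Extends (g.sing ∩ U) Y Y' p)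
    (eZ : Extends (g.sing ∩ U) Z Z' p) (eT : Extends (g.sing ∩ U) T T' p)
    (hF : SmoothNear F p) (hrep : ∀ᶠ x in 𝓝 p, g.Represents F Y' Z' x) :
    g.form p (D X (D Y Z) p) (T p) = g.dual X' F T' p +
      g.secondForm (g.sing ∩ U) N Y Z p * g.secondForm (g.sing ∩ U) N X T p := by
  have hW := hD.isFieldOn hg hrad hU hNR hflat hY hZ
  obtain ⟨W, eW⟩ := hW.1.exists_extends hp
  obtain ⟨N'', eN⟩ := hNR.normal_smooth.exists_extends hp
  have hh : SmoothFunNear m (g.dual Y' Z' N'') p := g.smoothFunNear_dual eY.1 eZ.1 eN.1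
  have hXt : IsTangentAt (g.sing ∩ U) p (X' p) := by
    rw [eX.eq hp]
    exact hX.2 p hp
  have hNT : ∀ᶠ q in 𝓝 p, q ∈ g.sing ∩ U → g.form q (N'' q) (T' q) = 0 := by
    filter_upwards [eN.2, eT.2] with q h1 h2 hq
    rw [h1 hq, h2 hq]
    exact hNR.orthogonal q hq _ (hT.2 q hq)
  have key := hD.form_eq hg hrad hU hNR hflat hX hW hp eX eW eT.1
  rw [eT.eq hp, hNR.orthogonal p hp _ (hT.2 p hp), mul_zero, sub_zero] at key
  -- A candidate for `∇^Σ_Y Z` built from the given `F`. The fields representing `□_Y Z` for two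
  -- choices of extensions may differ on `Σ` by a radical field, so agreement with `W` is only
  -- claimed modulo the radical.
  set W' : VField m M := F + (fun y ↦ -g.dual Y' Z' N'' y) • N'' with hW'
  have hW's : SmoothNear W' p := hF.add (eN.1.smul hh.neg)
  have hdiff : SmoothNear (W - W') p := eW.1.sub hW's
  have hradical : ∀ᶠ q in 𝓝 p, q ∈ g.sing ∩ U → g.IsRadical q ((W - W') q) := by
    have hps := mem_chart_source (EuclideanSpace ℝ (Fin m)) p
    filter_upwards [(chartAt (EuclideanSpace ℝ (Fin m)) p).open_source.mem_nhds hps, eW.2,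
      eY.eventually, eZ.eventually, eN.eventually, hrep] with q h1 h2 h3 h4 h5 h6 hq
    refine (g.isRadical_iff_frame h1 _).2 fun b ↦ ?_
    have hb := smoothNear_frame h1 b
    have h7 := hD.form_eq hg hrad hU hNR hflat hY hZ hq h3 h4 hb
    have h8 := h6 _ hb.diffAt
    rw [secondForm_eq hq h3 h4 h5 (hY.2 q hq)] at h7
    rw [Pi.sub_apply, map_sub, sub_apply, h2 hq, h7, hW', Pi.add_apply, Pi.smul_apply', map_add,
      map_smul, add_apply, smul_apply, h8, h5.eq hq, smul_eq_mul]
    ring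
  -- By metric compatibility a radical difference contributes `X⟨W - W',T⟩ - □_X T(W - W')`: the
  -- first term vanishes because `X` is tangent to `Σ`, the second by `II`-flatness.
  have hWW' : g.dual X' W T' p = g.dual X' W' T' p := by
    have h1 : W = W' + (W - W') := by abel
    have h2 := g.dual_add_dual_swap X' (W - W') T' p
    rw [hXt.dirDeriv_eq_zero (g.smoothFunNear_form hdiff eT.1)
        (hradical.mono fun q hq hqS ↦ hq hqS _),
      hflat.dual_eq_zero hg hrad hU hNR hX hT hp eX eT hdiff.diffAt (hradical.self_of_nhds hp),
      add_zero] at h2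
    rw [h1, g.dual_add_mid eX.diffAt hW's.diffAt hdiff.diffAt eT.diffAt, h2, add_zero]
  -- The Weingarten relation, from differentiating `⟨N,T⟩ = 0` along `Σ`.
  have hN : g.dual X' N'' T' p = -g.secondForm (g.sing ∩ U) N X T p := by
    have h1 := g.dual_add_dual_swap X' N'' T' p
    rw [hXt.dirDeriv_eq_zero (g.smoothFunNear_form eN.1 eT.1) hNT,
      ← secondForm_eq hp eX eT eN (hX.2 p hp)] at h1
    linarith
  rw [key, hWW', hW', g.dual_add_mid eX.diffAt hF.diffAt (eN.1.smul hh.neg).diffAt eT.diffAt,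
    g.dual_smul_mid eX.diffAt hh.neg.diffFunAt eN.diffAt eT.diffAt, hNT.self_of_nhds hp, hN,
    secondForm_eq hp eY eZ eN (hY.2 p hp)]
  ring

/-- The Gauss formula, in terms of smooth fields representing the dual derivatives. -/
theorem IsTangentialConnection.form_curvatureOn (hg : g.IsTransverseRiemannLorentz)
    (hrad : g.HasTangentRadical) (hU : IsOpen U) (hNR : g.IsMainPair (g.sing ∩ U) N R)
    (hflat : g.IsIIFlat U N R) (hD : g.IsTangentialConnection U N N' D)
    (hX : IsFieldOn (g.sing ∩ U) X) (hY : IsFieldOn (g.sing ∩ U) Y)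
    (hZ : IsFieldOn (g.sing ∩ U) Z) (hT : IsFieldOn (g.sing ∩ U) T) (hp : p ∈ g.sing ∩ U)
    (eX : Extends (g.sing ∩ U) X X' p) (eY : Extends (g.sing ∩ U) Y Y' p)
    (eZ : Extends (g.sing ∩ U) Z Z' p) (eT : Extends (g.sing ∩ U) T T' p)
    (hF : SmoothNear F p) (hrep : ∀ᶠ x in 𝓝 p, g.Represents F Y' Z' x)
    (hF' : SmoothNear F' p) (hrep' : ∀ᶠ x in 𝓝 p, g.Represents F' X' Z' x) :
    g.form p (curvatureOn (g.sing ∩ U) D X Y Z p) (T p) =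
      g.dual X' F T' p - g.dual Y' F' T' p - g.dual (mlieBracket (𝓡 m) X' Y') Z' T' p -
      Matrix.det !![g.secondForm (g.sing ∩ U) N X Z p, g.secondForm (g.sing ∩ U) N Y Z p;
        g.secondForm (g.sing ∩ U) N X T p, g.secondForm (g.sing ∩ U) N Y T p] := by
  have h1 := hD.form_second_derivative hg hrad hU hNR hflat hX hY hZ hT hp eX eY eZ eT hF hrep
  have h2 := hD.form_second_derivative hg hrad hU hNR hflat hY hX hZ hT hp eY eX eZ eT hF' hrep'
  have h3 := hD.form_eq hg hrad hU hNR hflat (hX.bracketOn hY) hZ hp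
    (extends_bracketOn hX hY eX eY) eZ eT.1
  rw [eT.eq hp, hNR.orthogonal p hp _ (hT.2 p hp), mul_zero, sub_zero] at h3
  rw [curvatureOn, map_sub, map_sub, sub_apply, sub_apply, h1, h2, h3, Matrix.det_fin_two_of]
  ring

theorem nabla_congr_right {B' : VField m M} (h : B =ᶠ[𝓝 p] B') :
    g.nabla A B p = g.nabla A B' p := by
  simp only [nabla, g.dual_congr_mid h]

theorem IsTransverseRiemannLorentz.form_nabla (hg : g.IsTransverseRiemannLorentz)
    (hA : SmoothNear A p) (hB : SmoothNear B p) (hC : DiffAt C p) (hp : p ∉ g.sing) :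
    g.form p (g.nabla A B p) (C p) = g.dual A B C p := by
  obtain ⟨F, -, hF⟩ := hg.exists_represents_off_sing hA hB hp
  rw [nabla_eq hF.self_of_nhds hp]
  exact hF.self_of_nhds C hC

/-- The right-hand side is the expression occurring in `IsTangentialConnection.form_curvatureOn`,
which is how the curvature off `Σ` is matched with data on `Σ`. -/
theorem IsTransverseRiemannLorentz.curv_eq (hg : g.IsTransverseRiemannLorentz) (hp : p ∉ g.sing)
    (hX : SmoothNear X p) (hY : SmoothNear Y p) (hZ : SmoothNear Z p) (hT : SmoothNear T p)
    (hF : SmoothNear F p) (hrep : ∀ᶠ x in 𝓝 p, g.Represents F Y Z x)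
    (hF' : SmoothNear F' p) (hrep' : ∀ᶠ x in 𝓝 p, g.Represents F' X Z x) :
    g.curv X Y Z T p =
      g.dual X F T p - g.dual Y F' T p - g.dual (mlieBracket (𝓡 m) X Y) Z T p := by
  have hoff := g.isClosed_sing.isOpen_compl.mem_nhds hp
  have h1 : g.nabla Y Z =ᶠ[𝓝 p] F := by
    filter_upwards [hrep, hoff] with x h1 h2 using nabla_eq h1 h2
  have h2 : g.nabla X Z =ᶠ[𝓝 p] F' := by
    filter_upwards [hrep', hoff] with x h1 h2 using nabla_eq h1 h2
  rw [curv, nabla_congr_right h1, nabla_congr_right h2, map_sub, map_sub, sub_apply, sub_apply,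
    hg.form_nabla hX hF hT.diffAt hp, hg.form_nabla hY hF' hT.diffAt hp,
    hg.form_nabla (hX.mlieBracket hY) hZ hT.diffAt hp]

end SymTensor

end RiemannLorentz

theorem mainTheorem4 {m : ℕ} (hm : 2 < m) {M : Type*} [TopologicalSpace M]
    [ChartedSpace (EuclideanSpace ℝ (Fin m)) M] [IsManifold (𝓡 m) ∞ M]
    [T2Space M] [SecondCountableTopology M] [ConnectedSpace M]
    (g : RiemannLorentz.SymTensor m M) (hg : g.IsTransverseRiemannLorentz)
    (hrad : g.HasTangentRadical)
    (U : Set M) (hU : IsOpen U) (N R : RiemannLorentz.VField m M)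
    (hNR : g.IsMainPair (g.sing ∩ U) N R) (hflat : g.IsIIFlat U N R)
    (N' : RiemannLorentz.VField m M) (hN' : g.IsGeodesicExtension U N N')
    (D : RiemannLorentz.VField m M → RiemannLorentz.VField m M → RiemannLorentz.VField m M)
    (hD : g.IsTangentialConnection U N N' D)
    (X Y Z T : RiemannLorentz.VField m M)
    (hX : RiemannLorentz.IsFieldOn (g.sing ∩ U) X) (hY : RiemannLorentz.IsFieldOn (g.sing ∩ U) Y)
    (hZ : RiemannLorentz.IsFieldOn (g.sing ∩ U) Z)
    (hT : RiemannLorentz.IsFieldOn (g.sing ∩ U) T) :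
    ∃ L : M → ℝ, g.IsCurvLimit U X Y Z T L ∧
      ∀ p ∈ g.sing ∩ U,
        g.form p (RiemannLorentz.curvatureOn (g.sing ∩ U) D X Y Z p) (T p) =
          L p - Matrix.det
            !![g.secondForm (g.sing ∩ U) N X Z p, g.secondForm (g.sing ∩ U) N Y Z p;
               g.secondForm (g.sing ∩ U) N X T p, g.secondForm (g.sing ∩ U) N Y T p] := by
  set S := g.sing ∩ U with hS
  -- The Gauss formula dictates the limit, and this value visibly involves no extensions; what
  -- remains is to prove that it is the limit.
  let L : M → ℝ := fun p ↦ g.form p (RiemannLorentz.curvatureOn S D X Y Z p) (T p) +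
    Matrix.det !![g.secondForm S N X Z p, g.secondForm S N Y Z p;
      g.secondForm S N X T p, g.secondForm S N Y T p]
  refine ⟨L, fun V hV hVU X' Y' Z' T' hX' hY' hZ' hT' ↦ ?_,
    fun p _ ↦ (add_sub_cancel_right _ _).symm⟩
  classical
  refine ⟨fun x ↦ if x ∈ g.sing then L x else g.curv X' Y' Z' T' x, fun x hx ↦ ?_,
    fun x hx ↦ if_neg hx.2, fun p hp ↦ if_pos hp.1⟩
  have eX := hX'.extends hV hx
  have eY := hY'.extends hV hx
  have eZ := hZ'.extends hV hx
  have eT := hT'.extends hV hx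
  obtain ⟨F, hF, hrep⟩ := hflat.exists_represents hg hrad hU hNR hY hZ (hVU hx) eY eZ
  obtain ⟨F', hF', hrep'⟩ := hflat.exists_represents hg hrad hU hNR hX hZ (hVU hx) eX eZ
  -- One smooth function near `x` agrees with the curvature off `Σ` and with `L` on `Σ`. The fields
  -- `F`, `F'` exist only locally, whereas the function defined by cases is global on `V`.
  have hsmooth : RiemannLorentz.SmoothFunNear m (fun y ↦ g.dual X' F T' y - g.dual Y' F' T' y -
      g.dual (mlieBracket (𝓡 m) X' Y') Z' T' y) x :=
    ((g.smoothFunNear_dual eX.1 hF eT.1).sub (g.smoothFunNear_dual eY.1 hF' eT.1)).sub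
      (g.smoothFunNear_dual (eX.1.mlieBracket eY.1) eZ.1 eT.1)
  refine (hsmooth.self_of_nhds.congr_of_eventuallyEq ?_).contMDiffWithinAt
  filter_upwards [hU.mem_nhds (hVU hx), eX.eventually, eY.eventually, eZ.eventually, eT.eventually,
    hF.eventually, hF'.eventually, hrep.eventually_nhds, hrep'.eventually_nhds]
    with y hy fX fY fZ fT hFy hFy' hrepy hrepy'
  by_cases hys : y ∈ g.sing
  · simp only [if_pos hys, L]
    rw [hD.form_curvatureOn hg hrad hU hNR hflat hX hY hZ hT ⟨hys, hy⟩ fX fY fZ fT hFy hrepy hFy'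
      hrepy', sub_add_cancel]
  · simp only [if_neg hys]
    exact hg.curv_eq hys fX.1 fY.1 fZ.1 fT.1 hFy hrepy hFy' hrepy'
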